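/- Consider a directed graph on the vertices $0,1,\dots,N$ ($0$ is the leader, $1,\dots,N$ are the followers) without self-loops and without edges into $0$. Let $a_{ij}=1$ if there is an edge from $j$ to $i$ and $a_{ij}=0$ otherwise, and let $\mathcal H=\mathcal L+\mathrm{diag}(a_{10},\dots,a_{N0})$, where $\mathcal L$ is the Laplacian of the followers, $\mathcal L_{ii}=\sum_{j=1}^N a_{ij}$ and $\mathcal L_{ij}=-a_{ij}$ for $i\neq j$ ($i,j\ge 1$). Assume that the graph has a directed spanning tree rooted at the leader. The leader is $\dot v=Sv$ with $S\in\mathbb R^{n\times n}$ neutrally stable, i.e. the complex eigenvalues of $S$ are semi-simple with zero real parts (for instance, $S$ skew-symmetric). For parameters $\mu_1,\mu_2,T,\iota_S,\gamma_S,\iota_v,\gamma_v>0$ let $t_k=kT$, $k=0,1,2,\dots$. The periodic event-triggered distributed observer is, for $i=1,\dots,N$ and $t\in[t_k,t_{k+1})$, $$\dot{\hat S}_i=\mu_1\sum_{j=0}^N a_{ij}\bigl(\hat S_j(\bar t^{\,j})-\hat S_i(\bar t^{\,i})\bigr),\qquad \dot{\hat v}_i=\hat S_i(\bar t^{\,i})\hat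 v_i(t)+\mu_2\sum_{j=0}^N a_{ij}\bigl(\bar v_j(t,\bar t^{\,j})-\bar v_i(t,\bar t^{\,i})\bigr),$$ where $\hat S_0\equiv S$, $\hat v_0=v$, $\bar v_i(t,s)=e^{\hat S_i(s)(t-s)}\hat v_i(s)$, the functions $\hat S_i,\hat v_i$ are continuous on $[0,\infty)$, and $\bar t^{\,i}=\bar t^{\,i}(k)$ is the latest event time of agent $i$ not later than $t_k$. The first event time of agent $i$ is $0$, and the event time following the event time $s$ is the first sampling instant $\tau=t_m>s$ (if there is one) at which $$\|\hat S_i(\tau)-\hat S_i(s)\|_F>\iota_S e^{-\gamma_S\tau}\quad\text{or}\quad \|\hat v_i(\tau)-\bar v_i(\tau,s)\|>\iota_v e^{-\gamma_v\tau}.$$ Say that the observer estimates the leader exponentially if there is $\lambda>0$ such that for every leader trajectory $v$ and all initial values $\hat S_i(0),\hat v_i(0)$ the observer has a solution on $[0,\infty)$, and for every such solution there is $C$ with $\|\hat S_i(t)-S\|_F\le Ce^{-\lambda t}$ and $\|\hat v_i(t)-v(t)\|\le Ce^{-\lambda t}$ for all $t\ge 0$ and $i=1,\dots,N$. Then: (1)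 There are parameters $\mu_1,\mu_2,T,\iota_S,\gamma_S,\iota_v,\gamma_v>0$, depending only on the graph, for which the observer estimates the leader exponentially, for every $n$ and every neutrally stable $S\in\mathbb R^{n\times n}$. (2) There is a symmetric positive definite $P\in\mathbb R^{N\times N}$ with $P\mathcal H+\mathcal H^{\mathsf T}P=2I$. (3) If $P\in\mathbb R^{N\times N}$ satisfies $P\mathcal H+\mathcal H^{\mathsf T}P=2I$, then for all $\mu_1,\mu_2,\iota_S,\gamma_S,\iota_v,\gamma_v>0$ and every sampling period $T$ with $$0<T<\frac{1}{\max\{\mu_1,\mu_2\}\,(\|P\mathcal H\|+1)\,\|\mathcal H\|}$$ ($\|\cdot\|$ the spectral norm), the observer estimates the leader exponentially, for every $n$ and every neutrally stable $S\in\mathbb R^{n\times n}$; in particular this bound on $T$ depends only on the graph and the gains, not on $S$. -/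

import Mathlib

open Set Matrix
open scoped BigOperators

noncomputable section

/-! ### Norms -/

/-- Euclidean norm of a real vector. -/
def eucNorm {n : ℕ} (x : Fin n → ℝ) : ℝ := ‖(WithLp.toLp 2 x : EuclideanSpace ℝ (Fin n))‖

/-- Frobenius norm of a real square matrix. -/
def frobNorm {n : ℕ} (A : Matrix (Fin n) (Fin n) ℝ) : ℝ := Real.sqrt (∑ r, ∑ c, A r c ^ 2)

/-- `2`-norm (spectral norm) of a real square matrix: its operator norm on Euclidean space. -/
def twoNorm {n : ℕ} (A : Matrix (Fin n) (Fin n) ℝ) : ℝ :=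
  ‖Matrix.toEuclideanCLM (n := Fin n) (𝕜 := ℝ) A‖

/-! ### The communication graph

The vertices are `Fin (N + 1)`: vertex `0` is the leader, `i.succ` (for `i : Fin N`) is a follower.
`G.Adj j i` means that there is an edge from `j` to `i`, i.e. `i` receives information from `j`. -/

/-- `G` contains a directed spanning tree with root `r`: a subgraph on all the vertices in which
the root has no incoming edge, every other vertex has exactly one incoming edge, and
every vertex is reached from the root by a directed path. -/
def HasDirectedSpanningTree {V : Type*} (G : Digraph V) (r : V) : Prop :=
  ∃ Tr : Digraph V, (∀ u w, Tr.Adj u w → G.Adj u w) ∧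
    (∀ u, ¬ Tr.Adj u r) ∧
    (∀ w, w ≠ r → ∃! u, Tr.Adj u w) ∧
    ∀ w, Relation.ReflTransGen Tr.Adj r w

open Classical in
/-- The weights: `a_{ij} = 1` if there is an edge from `j` to `i`, and `a_{ij} = 0` otherwise. -/
def weight {V : Type*} (G : Digraph V) (i j : V) : ℝ := if G.Adj j i then 1 else 0

/-- The weight matrix of the followers. -/
def followerWeights {N : ℕ} (G : Digraph (Fin (N + 1))) : Matrix (Fin N) (Fin N) ℝ :=
  Matrix.of fun i j => weight G i.succ j.succ

/-- The Laplacian matrix of the subgraph of the followers. -/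
def followerLaplacian {N : ℕ} (G : Digraph (Fin (N + 1))) : Matrix (Fin N) (Fin N) ℝ :=
  Matrix.diagonal (fun i => ∑ j, followerWeights G i j) - followerWeights G

/-- The matrix `H = L + diag(a_{10}, …, a_{N0})`. -/
def graphH {N : ℕ} (G : Digraph (Fin (N + 1))) : Matrix (Fin N) (Fin N) ℝ :=
  followerLaplacian G + Matrix.diagonal fun i => weight G i.succ 0

/-! ### The leader -/

/-- Neutral stability: the (complex) eigenvalues of `S` have zero real part and are semi-simple,
i.e. their generalized eigenspaces are their eigenspaces. -/
def NeutrallyStable {n : ℕ} (S : Matrix (Fin n) (Fin n) ℝ) : Prop :=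
  ∀ z : ℂ, Module.End.HasEigenvalue (Matrix.toLin' (S.map (algebraMap ℝ ℂ))) z →
    z.re = 0 ∧
    Module.End.maxGenEigenspace (Matrix.toLin' (S.map (algebraMap ℝ ℂ))) z =
      Module.End.eigenspace (Matrix.toLin' (S.map (algebraMap ℝ ℂ))) z

/-- `v` is a trajectory of the leader `v' = S v` on `[0, ∞)`. -/
def IsLeaderTrajectory {n : ℕ} (S : Matrix (Fin n) (Fin n) ℝ) (v : ℝ → Fin n → ℝ) : Prop :=
  ∀ t : ℝ, 0 ≤ t → HasDerivWithinAt v (S *ᵥ v t) (Ici 0) t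

/-! ### The periodic event-triggered distributed observer -/

/-- The design parameters: the gains `μ₁, μ₂`, the sampling period `T`, and the parameters of the
triggering thresholds `ιS e^{-γS τ}` and `ιv e^{-γv τ}`. -/
structure PETParams where
  μ₁ : ℝ
  μ₂ : ℝ
  T : ℝ
  ιS : ℝ
  γS : ℝ
  ιv : ℝ
  γv : ℝ
  μ₁_pos : 0 < μ₁
  μ₂_pos : 0 < μ₂
  T_pos : 0 < T
  ιS_pos : 0 < ιS
  γS_pos : 0 < γS
  ιv_pos : 0 < ιv
  γv_pos : 0 < γv

section Agent

variable {n : ℕ}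

/-- The prediction `e^{Ŝ(s) (t - s)} v̂(s)` made from the data that an agent sent at time `s`. -/
def vbar (Sh : ℝ → Matrix (Fin n) (Fin n) ℝ) (vh : ℝ → Fin n → ℝ) (s t : ℝ) : Fin n → ℝ :=
  NormedSpace.exp ((t - s) • Sh s) *ᵥ vh s

/-- The triggering function `f_S(τ, s)`. -/
def trigS (p : PETParams) (Sh : ℝ → Matrix (Fin n) (Fin n) ℝ) (τ s : ℝ) : ℝ :=
  frobNorm (Sh τ - Sh s) - p.ιS * Real.exp (-p.γS * τ)

/-- The triggering function `f_v(τ, s)`. -/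
def trigV (p : PETParams) (Sh : ℝ → Matrix (Fin n) (Fin n) ℝ) (vh : ℝ → Fin n → ℝ)
    (τ s : ℝ) : ℝ :=
  eucNorm (vh τ - vbar Sh vh s τ) - p.ιv * Real.exp (-p.γv * τ)

open Classical in
/-- The latest event time of an agent on `[kT, (k+1)T)`. The first event time is `0`, and the event
time that follows `s` is the first sampling instant `τ > s` at which one of the two triggering
functions is positive; so at each sampling instant either a new event occurs, or the latest event
time is kept (for ever, if there is no further event). -/
def latestEvent (p : PETParams) (Sh : ℝ → Matrix (Fin n) (Fin n) ℝ) (vh : ℝ → Fin n → ℝ) :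
    ℕ → ℝ
  | 0 => 0
  | k + 1 =>
    if 0 < trigS p Sh (((k + 1 : ℕ) : ℝ) * p.T) (latestEvent p Sh vh k) ∨
        0 < trigV p Sh vh (((k + 1 : ℕ) : ℝ) * p.T) (latestEvent p Sh vh k)
    then ((k + 1 : ℕ) : ℝ) * p.T
    else latestEvent p Sh vh k

end Agent

/-- The sampling interval `[kT, (k+1)T)`. -/
def samplingInterval (p : PETParams) (k : ℕ) : Set ℝ :=
  Ico ((k : ℝ) * p.T) (((k + 1 : ℕ) : ℝ) * p.T)

/-- `Sh, vh` is a trajectory on `[0, ∞)` of the periodic event-triggered distributed observer over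
the graph `G` for the leader matrix `S` and the leader trajectory `v`. Index `0` is the leader. The
trajectories are continuous and satisfy the differential equations on each sampling interval
(at its left end as a right derivative). -/
structure IsObserverTrajectory {N n : ℕ} (G : Digraph (Fin (N + 1))) (p : PETParams)
    (S : Matrix (Fin n) (Fin n) ℝ) (v : ℝ → Fin n → ℝ)
    (Sh : Fin (N + 1) → ℝ → Matrix (Fin n) (Fin n) ℝ)
    (vh : Fin (N + 1) → ℝ → Fin n → ℝ) : Prop where
  leader_S : ∀ t, 0 ≤ t → Sh 0 t = S
  leader_v : ∀ t, 0 ≤ t → vh 0 t = v t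
  continuous_S : ∀ i : Fin N, ContinuousOn (Sh i.succ) (Ici 0)
  continuous_v : ∀ i : Fin N, ContinuousOn (vh i.succ) (Ici 0)
  deriv_S : ∀ (i : Fin N) (k : ℕ), ∀ t ∈ samplingInterval p k,
    HasDerivWithinAt (Sh i.succ)
      (p.μ₁ • ∑ j, weight G i.succ j •
        (Sh j (latestEvent p (Sh j) (vh j) k) -
          Sh i.succ (latestEvent p (Sh i.succ) (vh i.succ) k)))
      (samplingInterval p k) t
  deriv_v : ∀ (i : Fin N) (k : ℕ), ∀ t ∈ samplingInterval p k,
    HasDerivWithinAt (vh i.succ)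
      (Sh i.succ (latestEvent p (Sh i.succ) (vh i.succ) k) *ᵥ vh i.succ t +
        p.μ₂ • ∑ j, weight G i.succ j •
          (vbar (Sh j) (vh j) (latestEvent p (Sh j) (vh j) k) t -
            vbar (Sh i.succ) (vh i.succ) (latestEvent p (Sh i.succ) (vh i.succ) k) t))
      (samplingInterval p k) t

/-- The observer with parameters `p` estimates the leader exponentially: for every leader
trajectory and all initial estimates, observer trajectories exist on `[0, ∞)`, and along each of
them `Ŝ_i - S` and `v̂_i - v` converge to zero exponentially for every follower, with a rate that is
the same for all initial values. -/
def ExponentiallyEstimates {N n : ℕ} (G : Digraph (Fin (N + 1))) (p : PETParams)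
    (S : Matrix (Fin n) (Fin n) ℝ) : Prop :=
  ∃ rate : ℝ, 0 < rate ∧
    ∀ v : ℝ → Fin n → ℝ, IsLeaderTrajectory S v →
    ∀ (S₀ : Fin N → Matrix (Fin n) (Fin n) ℝ) (v₀ : Fin N → Fin n → ℝ),
      (∃ Sh vh, IsObserverTrajectory G p S v Sh vh ∧
        ∀ i : Fin N, Sh i.succ 0 = S₀ i ∧ vh i.succ 0 = v₀ i) ∧
      ∀ Sh vh, IsObserverTrajectory G p S v Sh vh →
        (∀ i : Fin N, Sh i.succ 0 = S₀ i ∧ vh i.succ 0 = v₀ i) →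
        ∃ C : ℝ, ∀ t : ℝ, 0 ≤ t → ∀ i : Fin N,
          frobNorm (Sh i.succ t - S) ≤ C * Real.exp (-rate * t) ∧
          eucNorm (vh i.succ t - v t) ≤ C * Real.exp (-rate * t)

end

/-! The matrix `graphH G` is a nonsingular M-matrix: its off-diagonal entries are nonpositive, its
row sums nonnegative, and the spanning tree yields a positive vector with positive image
(`exists_pos_graphH_mulVec_pos`). Short Euler steps `1 - a • H` are then nonnegative matrices with
powers tending to zero. This makes the Lyapunov operator injective (`lyapunov_eq_zero`), hence
bijective, and forces every solution `P` to be positive definite (`lyapunov_posDef`).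

The square root of `x ⬝ᵥ (P *ᵥ x)` is then a norm in which the step `x ↦ x - a H x` contracts as
soon as `a * ((‖PH‖ + 1) * ‖H‖) ≤ 1` (`lyapunov_step`, `exists_stepContracts`). With `a = μ * T`
this is the bound on the sampling period.

From one sampling instant to the next, the errors of the matrix estimates perform such a step, up to
the deviation since the last event, which the trigger keeps below an exponentially small threshold.
So they decay geometrically (`exists_matrix_bound`).

The vector estimates are read in the frame moving with `e^{tS}`. There the leader stands still, the
drift `S` cancels, and the predictions are constant up to terms of the size of the matrix errors and
thresholds. What remains is again an Euler step with a geometrically small perturbation, part of it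
proportional to the state (`exists_vector_bound`). Neutral stability enters only through the
boundedness of `e^{tS}` on the whole line, so that changing frames costs a constant factor; hence
`S` does not affect the condition on `T`.

Both decay statements rest on `exists_decay_bound`. Trajectories exist because each sampling
interval is a linear problem determined by the past (`exists_isObserverTrajectory`). -/

noncomputable section

/-! ### The graph matrix and a positive vector with positive image -/

section Graph

/-- The depth is the length of a shortest walk from the root: the last edge of a shortest walk comes
from a vertex of smaller depth. In the proof, `R m w` says that some walk of exactly `m` edges leads
from `r` to `w`. -/
lemma exists_depth {V : Type*} (G : Digraph V) (r : V) (h : HasDirectedSpanningTree G r) :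
    ∃ d : V → ℕ, d r = 0 ∧ ∀ w, w ≠ r → ∃ u, G.Adj u w ∧ d u < d w := by
  obtain ⟨Tr, hsub, -, -, hreach⟩ := h
  let R : ℕ → V → Prop := Nat.rec (fun w => w = r) fun _ Q w => ∃ u, Q u ∧ G.Adj u w
  have hR : ∀ w, ∃ m, R m w := by
    intro w
    induction hreach w with
    | refl => exact ⟨0, rfl⟩
    | tail _ hbc ih => exact ⟨ih.choose + 1, _, ih.choose_spec, hsub _ _ hbc⟩
  refine ⟨fun w => sInf {m | R m w}, Nat.sInf_eq_zero.2 (Or.inl rfl), fun w hw => ?_⟩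
  have hs : R (sInf {m | R m w}) w := Nat.sInf_mem (hR w)
  rcases hm : sInf {m | R m w} with _ | m
  · rw [hm] at hs
    exact absurd hs hw
  · rw [hm] at hs
    obtain ⟨u, hu, hadj⟩ := hs
    exact ⟨u, hadj, by simpa only [hm] using Nat.lt_succ_of_le (Nat.sInf_le (s := {m | R m u}) hu)⟩

variable {N : ℕ} (G : Digraph (Fin (N + 1)))

lemma weight_nonneg {V : Type*} (G : Digraph V) (i j : V) : 0 ≤ weight G i j := by
  unfold weight; split_ifs <;> norm_num

lemma weight_le_one {V : Type*} (G : Digraph V) (i j : V) : weight G i j ≤ 1 := by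
  unfold weight; split_ifs <;> norm_num

lemma sum_graphH_smul {E : Type*} [AddCommGroup E] [Module ℝ E] (x : Fin N → E) (i : Fin N) :
    ∑ j, graphH G i j • x j
      = weight G i.succ 0 • x i + ∑ j : Fin N, weight G i.succ j.succ • (x i - x j) := by
  have : ∀ j, graphH G i j • x j = (if i = j then (∑ l, weight G i.succ (Fin.succ l)) • x j else 0)
      + (if i = j then weight G i.succ 0 • x j else 0) - weight G i.succ j.succ • x j := by
    intro j
    by_cases h : i = j
    · subst h
      simp [graphH, followerLaplacian, followerWeights, add_smul, sub_smul]
      abel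
    · simp [graphH, followerLaplacian, followerWeights, h, neg_smul]
  simp only [this, Finset.sum_add_distrib, Finset.sum_sub_distrib, Finset.sum_ite_eq,
    Finset.mem_univ, if_true, smul_sub, Finset.sum_smul]
  abel

/-- The consensus error seen by follower `i`, in terms of the matrix `H`. -/
lemma sum_weight_smul_sub {E : Type*} [AddCommGroup E] [Module ℝ E] (y : Fin (N + 1) → E)
    (i : Fin N) :
    ∑ j, weight G i.succ j • (y j - y i.succ) = -∑ j, graphH G i j • (y j.succ - y 0) := by
  rw [sum_graphH_smul, Fin.sum_univ_succ, neg_add, ← smul_neg, ← Finset.sum_neg_distrib]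
  congr 1
  · rw [neg_sub]
  · refine Finset.sum_congr rfl fun j _ => ?_
    rw [← smul_neg]
    congr 1
    abel

lemma graphH_offDiag {i j : Fin N} (h : i ≠ j) : graphH G i j ≤ 0 := by
  simpa [graphH, followerLaplacian, followerWeights, h] using weight_nonneg G i.succ j.succ

lemma graphH_rowSum (i : Fin N) : 0 ≤ ∑ j, graphH G i j := by
  have := sum_graphH_smul G (fun _ => (1 : ℝ)) i
  simp only [smul_eq_mul, mul_one, sub_self, mul_zero, Finset.sum_const_zero, add_zero] at this
  rw [this]
  exact weight_nonneg _ _ _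

/-- The vector is `1 - δ ^ depth`, which vanishes at the leader. For small `δ`, the gap to one
neighbour closer to the leader outweighs the gaps to all the other neighbours. -/
lemma exists_pos_graphH_mulVec_pos (h : HasDirectedSpanningTree G 0) :
    ∃ w : Fin N → ℝ, (∀ i, 0 < w i) ∧ ∀ i, 0 < (graphH G *ᵥ w) i := by
  obtain ⟨d, hd0, hd⟩ := exists_depth G 0 h
  -- With depth `m + 1`, the shallower neighbour contributes at most `δ ^ (m + 1) - δ ^ m` and each
  -- of the `N` other vertices at most `δ ^ (m + 1)`, so `(N + 1) * δ < 1` is what is needed.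
  set δ : ℝ := 1 / (N + 2) with hδ
  have hδ0 : 0 < δ := by positivity
  have hδN : δ * (N + 2) = 1 := by rw [hδ]; field_simp
  have hδ1 : δ < 1 := by nlinarith [(Nat.cast_nonneg N : (0 : ℝ) ≤ N)]
  have hdpos : ∀ i : Fin N, d i.succ ≠ 0 := fun i => by
    obtain ⟨u, _, hu⟩ := hd i.succ (Fin.succ_ne_zero i)
    omega
  refine ⟨fun i => 1 - δ ^ d i.succ, fun i => sub_pos.2 (pow_lt_one₀ hδ0.le hδ1 (hdpos i)),
    fun i => ?_⟩
  have key := sum_weight_smul_sub G (fun j => 1 - δ ^ d j) i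
  simp only [smul_eq_mul, hd0, pow_zero, sub_self, sub_zero] at key
  change 0 < ∑ j, graphH G i j * (1 - δ ^ d j.succ)
  rw [← neg_neg (∑ j, graphH G i j * (1 - δ ^ d j.succ)), ← key]
  obtain ⟨u, hu, hdu⟩ := hd i.succ (Fin.succ_ne_zero i)
  rw [← Finset.add_sum_erase _ _ (Finset.mem_univ u)]
  have hw : weight G i.succ u = 1 := by simp [weight, hu]
  have h1 : ∑ x ∈ Finset.univ.erase u, weight G i.succ x * (1 - δ ^ d x - (1 - δ ^ d i.succ))
      ≤ ∑ x ∈ Finset.univ.erase u, δ ^ d i.succ := by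
    refine Finset.sum_le_sum fun x _ => ?_
    have h2 : 0 < δ ^ d x := by positivity
    have h3 : 0 < δ ^ d i.succ := by positivity
    nlinarith [weight_nonneg G i.succ x, weight_le_one G i.succ x]
  rw [Finset.sum_const, Finset.card_erase_of_mem (Finset.mem_univ u)] at h1
  simp only [Finset.card_univ, Fintype.card_fin, Nat.add_sub_cancel, nsmul_eq_mul] at h1
  rw [hw]
  obtain ⟨m, hm⟩ : ∃ m, d i.succ = m + 1 := ⟨d i.succ - 1, by omega⟩
  have h4 : δ ^ m ≤ δ ^ d u := pow_le_pow_of_le_one hδ0.le hδ1.le (by omega)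
  have h5 : 0 < δ ^ m := by positivity
  rw [hm, pow_succ] at h1 ⊢
  nlinarith

end Graph

/-! ### Lyapunov equation of a nonsingular M-matrix -/

section MMatrix

variable {N : ℕ} {H : Matrix (Fin N) (Fin N) ℝ}

/-- Forward Euler steps along a matrix with nonpositive off-diagonal entries, nonnegative row sums
and a positive vector with positive image are nonnegative, substochastic and contract a weighted
sup norm. -/
lemma exists_step_contract (hoff : ∀ i j, i ≠ j → H i j ≤ 0) {w : Fin N → ℝ} (hw : ∀ i, 0 < w i)
    (hHw : ∀ i, 0 < (H *ᵥ w) i) :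
    ∃ a₀ : ℝ, 0 < a₀ ∧ ∀ a, 0 < a → a ≤ a₀ → (∀ i j, 0 ≤ (1 - a • H) i j) ∧
      ∃ q : ℝ, 0 ≤ q ∧ q < 1 ∧ ∀ i, ((1 - a • H) *ᵥ w) i ≤ q * w i := by
  have hsum : 0 ≤ ∑ i, |H i i| := Finset.sum_nonneg fun i _ => abs_nonneg _
  -- Below this bound the diagonal entries `1 - a * H i i` stay nonnegative.
  refine ⟨1 / (1 + ∑ i, |H i i|), by positivity, fun a ha ha0 => ?_⟩
  rw [le_div_iff₀ (by positivity)] at ha0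
  have hnn : ∀ i j, 0 ≤ (1 - a • H) i j := by
    intro i j
    by_cases h : i = j
    · subst h
      have h1 : |H i i| ≤ ∑ i, |H i i| :=
        Finset.single_le_sum (f := fun i => |H i i|) (fun i _ => abs_nonneg _) (Finset.mem_univ i)
      have h2 := le_abs_self (H i i)
      simp only [Matrix.sub_apply, one_apply_eq, Matrix.smul_apply, smul_eq_mul]
      nlinarith
    · simp only [Matrix.sub_apply, one_apply_ne h, Matrix.smul_apply, smul_eq_mul]
      nlinarith [hoff i j h]
  refine ⟨hnn, ?_⟩
  have hlt : ∀ i, ((1 - a • H) *ᵥ w) i < w i := fun i => by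
    rw [sub_mulVec, one_mulVec, smul_mulVec, Pi.sub_apply, Pi.smul_apply, smul_eq_mul]
    nlinarith [hHw i]
  rcases isEmpty_or_nonempty (Fin N) with hN | hN
  · exact ⟨0, le_rfl, one_pos, fun i => isEmptyElim i⟩
  -- The contraction factor is the largest of the finitely many ratios, each below `1`.
  · obtain ⟨i₀, hi₀⟩ := Finite.exists_max fun i => ((1 - a • H) *ᵥ w) i / w i
    refine ⟨((1 - a • H) *ᵥ w) i₀ / w i₀, div_nonneg ?_ (hw _).le, (div_lt_one (hw _)).2 (hlt _),
      fun i => (div_le_iff₀ (hw i)).1 (hi₀ i)⟩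
    change 0 ≤ ∑ j, (1 - a • H) i₀ j * w j
    exact Finset.sum_nonneg fun j _ => mul_nonneg (hnn i₀ j) (hw j).le

/-- A nonnegative matrix preserves bounds `|x| ≤ c * w`, and each application shrinks the bound by
the factor `q`. -/
lemma tendsto_pow_mulVec {M : Matrix (Fin N) (Fin N) ℝ} (hM : ∀ i j, 0 ≤ M i j)
    {w : Fin N → ℝ} (hw : ∀ i, 0 < w i) {q : ℝ} (hq0 : 0 ≤ q) (hq : q < 1)
    (hMw : ∀ i, (M *ᵥ w) i ≤ q * w i) (x : Fin N → ℝ) :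
    Filter.Tendsto (fun k : ℕ => (M ^ k) *ᵥ x) Filter.atTop (nhds 0) := by
  obtain ⟨c, hc0, hc⟩ : ∃ c : ℝ, 0 ≤ c ∧ ∀ i, |x i| ≤ c * w i := by
    refine ⟨∑ i, |x i| / w i, Finset.sum_nonneg fun i _ => div_nonneg (abs_nonneg _) (hw i).le,
      fun i => ?_⟩
    rw [← div_le_iff₀ (hw i)]
    exact Finset.single_le_sum (f := fun i => |x i| / w i)
      (fun i _ => div_nonneg (abs_nonneg _) (hw i).le) (Finset.mem_univ i)
  have hb : ∀ k i, |((M ^ k) *ᵥ x) i| ≤ q ^ k * (c * w i) := by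
    intro k
    induction k with
    | zero => simpa using hc
    | succ k ih =>
      intro i
      rw [pow_succ', ← mulVec_mulVec]
      calc |∑ j, M i j * ((M ^ k) *ᵥ x) j| ≤ ∑ j, M i j * (q ^ k * (c * w j)) := by
            refine (Finset.abs_sum_le_sum_abs _ _).trans (Finset.sum_le_sum fun j _ => ?_)
            rw [abs_mul, abs_of_nonneg (hM i j)]
            exact mul_le_mul_of_nonneg_left (ih j) (hM i j)
        _ = q ^ k * c * (M *ᵥ w) i := by
            simp only [mulVec, dotProduct, Finset.mul_sum]
            exact Finset.sum_congr rfl fun j _ => by ring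
        _ ≤ q ^ k * c * (q * w i) := by gcongr; exact hMw i
        _ = _ := by ring
  rw [tendsto_pi_nhds]
  intro i
  refine squeeze_zero_norm (fun k => hb k i) ?_
  simpa using (tendsto_pow_atTop_nhds_zero_of_lt_one hq0 hq).mul_const (c * w i)

/-- Uniqueness for the Lyapunov equation of a nonsingular M-matrix. -/
lemma lyapunov_eq_zero (hoff : ∀ i j, i ≠ j → H i j ≤ 0) (hrow : ∀ i, 0 ≤ ∑ j, H i j)
    {w : Fin N → ℝ} (hw : ∀ i, 0 < w i) (hHw : ∀ i, 0 < (H *ᵥ w) i)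
    {X : Matrix (Fin N) (Fin N) ℝ} (hX : X * H + Hᵀ * X = 0) : X = 0 := by
  obtain ⟨a, ha, hstep⟩ := exists_step_contract hoff hw hHw
  obtain ⟨hM, q, hq0, hq, hMw⟩ := hstep a ha le_rfl
  set M := 1 - a • H with hMdef
  -- `X` intertwines `M`, whose powers tend to zero, with `2 - Mᵀ`, which never decreases the `ℓ¹`
  -- norm. Hence `‖X v‖₁ ≤ ‖X M ^ k v‖₁ → 0`.
  have hcomm : X * M = (2 • 1 - Mᵀ) * X := by
    have h1 : X * H = -(Hᵀ * X) := eq_neg_of_add_eq_zero_left hX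
    simp only [hMdef, transpose_sub, transpose_one, transpose_smul, mul_sub, sub_mul, mul_one,
      one_mul, Matrix.mul_smul, Matrix.smul_mul, h1, two_smul, add_mul]
    simp
  have hpow : ∀ k : ℕ, X * M ^ k = (2 • 1 - Mᵀ) ^ k * X := by
    intro k
    induction k with
    | zero => simp
    | succ k ih => rw [pow_succ, ← mul_assoc, ih, mul_assoc, hcomm, ← mul_assoc, ← pow_succ]
  have hrowM : ∀ i, ∑ j, M i j ≤ 1 := fun i => by
    simp only [hMdef, Matrix.sub_apply, Matrix.smul_apply, Finset.sum_sub_distrib, smul_eq_mul, ← Finset.mul_sum,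
      one_apply, Finset.sum_ite_eq, Finset.mem_univ, if_true]
    nlinarith [hrow i]
  -- The row sums of `M` are at most `1`, so `Mᵀ` does not increase the `ℓ¹` norm, and the triangle
  -- inequality leaves `2 - 1 = 1`.
  have hexp : ∀ y : Fin N → ℝ, ∑ i, |y i| ≤ ∑ i, |((2 • 1 - Mᵀ) *ᵥ y) i| := by
    intro y
    have h1 : ∑ i, |(Mᵀ *ᵥ y) i| ≤ ∑ i, |y i| := by
      calc ∑ i, |(Mᵀ *ᵥ y) i| ≤ ∑ i, ∑ j, M j i * |y j| := by
            refine Finset.sum_le_sum fun i _ => ?_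
            change |∑ j, Mᵀ i j * y j| ≤ _
            refine (Finset.abs_sum_le_sum_abs (fun j => Mᵀ i j * y j) _).trans
              (Finset.sum_le_sum fun j _ => ?_)
            rw [transpose_apply, abs_mul, abs_of_nonneg (hM j i)]
        _ = ∑ j, (∑ i, M j i) * |y j| := by
            rw [Finset.sum_comm]
            exact Finset.sum_congr rfl fun j _ => by rw [Finset.sum_mul]
        _ ≤ ∑ j, |y j| := Finset.sum_le_sum fun j _ => by
            nlinarith [hrowM j, abs_nonneg (y j)]
    have h2 : ∀ i, 2 * |y i| - |(Mᵀ *ᵥ y) i| ≤ |((2 • 1 - Mᵀ) *ᵥ y) i| := fun i => by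
      have h3 : ((2 • 1 - Mᵀ) *ᵥ y) i = 2 * y i - (Mᵀ *ᵥ y) i := by
        rw [sub_mulVec, two_smul, add_mulVec, one_mulVec, Pi.sub_apply, Pi.add_apply]; ring
      rw [h3]
      have := abs_sub_abs_le_abs_sub (2 * y i) ((Mᵀ *ᵥ y) i)
      rwa [abs_mul, abs_two] at this
    have h4 := Finset.sum_le_sum fun i (_ : i ∈ Finset.univ) => h2 i
    rw [Finset.sum_sub_distrib, ← Finset.mul_sum] at h4
    linarith
  have hexpk : ∀ (k : ℕ) (y : Fin N → ℝ),
      ∑ i, |y i| ≤ ∑ i, |(((2 • 1 - Mᵀ) ^ k) *ᵥ y) i| := by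
    intro k
    induction k with
    | zero => intro y; simp
    | succ k ih =>
      intro y
      rw [pow_succ', ← mulVec_mulVec]
      exact (ih y).trans (hexp _)
  have hXv : ∀ v, X *ᵥ v = 0 := by
    intro v
    have hlim := tendsto_pow_mulVec hM hw hq0 hq hMw v
    have hcont : Continuous fun y : Fin N → ℝ => ∑ i, |(X *ᵥ y) i| := by
      fun_prop
    have hlim2 := (hcont.tendsto 0).comp hlim
    have hle : ∑ i, |(X *ᵥ v) i| ≤ 0 := by
      refine ge_of_tendsto (x := Filter.atTop) (a := (0 : ℝ))
        (f := fun k : ℕ => ∑ i, |(X *ᵥ ((M ^ k) *ᵥ v)) i|) ?_ (Filter.Eventually.of_forall ?_)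
      · simpa [Function.comp_def] using hlim2
      · intro k
        simp only [mulVec_mulVec, hpow]
        simpa only [mulVec_mulVec] using hexpk k (X *ᵥ v)
    ext i
    have := (Finset.sum_eq_zero_iff_of_nonneg fun i _ => abs_nonneg _).1
      (le_antisymm hle (Finset.sum_nonneg fun i _ => abs_nonneg ((X *ᵥ v) i))) i (Finset.mem_univ i)
    simpa using this
  ext i j
  have := congrFun (hXv (Pi.single j 1)) i
  simpa using this

lemma abs_dotProduct_mulVec_le (A B : Matrix (Fin N) (Fin N) ℝ) (x : Fin N → ℝ) :
    |(A *ᵥ x) ⬝ᵥ (B *ᵥ x)| ≤ twoNorm A * twoNorm B * (x ⬝ᵥ x) := by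
  set y : EuclideanSpace ℝ (Fin N) := WithLp.toLp 2 x
  have hy : x ⬝ᵥ x = ‖y‖ ^ 2 := by
    rw [EuclideanSpace.norm_sq_eq]
    simp [y, dotProduct, sq]
  have h1 : (A *ᵥ x) ⬝ᵥ (B *ᵥ x) = inner ℝ (Matrix.toEuclideanCLM (n := Fin N) (𝕜 := ℝ) B y)
      (Matrix.toEuclideanCLM (n := Fin N) (𝕜 := ℝ) A y) := by
    simp [y, PiLp.inner_apply, dotProduct]
  rw [h1, hy]
  refine (abs_real_inner_le_norm _ _).trans ?_
  have hA := (Matrix.toEuclideanCLM (n := Fin N) (𝕜 := ℝ) A).le_opNorm y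
  have hB := (Matrix.toEuclideanCLM (n := Fin N) (𝕜 := ℝ) B).le_opNorm y
  calc _ ≤ (twoNorm B * ‖y‖) * (twoNorm A * ‖y‖) :=
        mul_le_mul hB hA (norm_nonneg _) (mul_nonneg (norm_nonneg _) (norm_nonneg _))
    _ = _ := by ring

lemma twoNorm_nonneg (A : Matrix (Fin N) (Fin N) ℝ) : 0 ≤ twoNorm A := norm_nonneg _

/-- A short Euler step decreases the Lyapunov function. -/
lemma lyapunov_step {P : Matrix (Fin N) (Fin N) ℝ} (hP : P * H + Hᵀ * P = (2 : ℝ) • 1)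
    {a : ℝ} (ha : 0 ≤ a) (ha1 : a * ((twoNorm (P * H) + 1) * twoNorm H) ≤ 1) (x : Fin N → ℝ) :
    ((1 - a • H) *ᵥ x) ⬝ᵥ (P *ᵥ ((1 - a • H) *ᵥ x)) ≤ x ⬝ᵥ (P *ᵥ x) - a * (x ⬝ᵥ x) := by
  have h1 : ((1 - a • H) *ᵥ x) ⬝ᵥ (P *ᵥ ((1 - a • H) *ᵥ x)) = x ⬝ᵥ (P *ᵥ x)
      - a * (x ⬝ᵥ ((P * H + Hᵀ * P) *ᵥ x)) + a ^ 2 * ((H *ᵥ x) ⬝ᵥ ((P * H) *ᵥ x)) := by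
    have h2 : x ⬝ᵥ (Hᵀ *ᵥ (P *ᵥ x)) = (H *ᵥ x) ⬝ᵥ (P *ᵥ x) := by
      rw [dotProduct_mulVec, vecMul_transpose]
    simp only [sub_mulVec, one_mulVec, smul_mulVec, mulVec_sub, mulVec_smul, sub_dotProduct,
      dotProduct_sub, smul_dotProduct, dotProduct_smul, smul_eq_mul, add_mulVec, dotProduct_add,
      ← mulVec_mulVec, h2]
    ring
  rw [h1, hP, smul_mulVec, one_mulVec, dotProduct_smul, smul_eq_mul]
  have h3 := (le_abs_self _).trans (abs_dotProduct_mulVec_le H (P * H) x)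
  have hxx : 0 ≤ x ⬝ᵥ x := Finset.sum_nonneg fun i _ => mul_self_nonneg _
  have hH := twoNorm_nonneg H
  have hPH := twoNorm_nonneg (P * H)
  have h4 : a * (twoNorm H * twoNorm (P * H)) ≤ 1 := by nlinarith [mul_nonneg ha hH]
  -- Half of the decrease `2 * a * (x ⬝ᵥ x)` supplied by the Lyapunov equation pays for the
  -- quadratic term.
  have h5 : a ^ 2 * ((H *ᵥ x) ⬝ᵥ ((P * H) *ᵥ x)) ≤ a * (x ⬝ᵥ x) := by
    calc a ^ 2 * ((H *ᵥ x) ⬝ᵥ ((P * H) *ᵥ x))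
        ≤ a ^ 2 * (twoNorm H * twoNorm (P * H) * (x ⬝ᵥ x)) := by gcongr
      _ = (a * (twoNorm H * twoNorm (P * H))) * (a * (x ⬝ᵥ x)) := by ring
      _ ≤ 1 * (a * (x ⬝ᵥ x)) := by gcongr
      _ = _ := one_mul _
  linarith

/-- Solutions of the Lyapunov equation of a nonsingular M-matrix are positive definite. -/
lemma lyapunov_posDef (hoff : ∀ i j, i ≠ j → H i j ≤ 0) (hrow : ∀ i, 0 ≤ ∑ j, H i j)
    {w : Fin N → ℝ} (hw : ∀ i, 0 < w i) (hHw : ∀ i, 0 < (H *ᵥ w) i)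
    {P : Matrix (Fin N) (Fin N) ℝ} (hP : P * H + Hᵀ * P = (2 : ℝ) • 1) : P.PosDef := by
  -- `Pᵀ` solves the same equation, so symmetry follows from uniqueness.
  have hsymm : Pᵀ = P := by
    rw [← sub_eq_zero]
    refine lyapunov_eq_zero hoff hrow hw hHw ?_
    have h := congrArg transpose hP
    rw [transpose_add, transpose_mul, transpose_mul, transpose_transpose, transpose_smul,
      transpose_one] at h
    rw [sub_mul, mul_sub, ← sub_eq_zero.2 (h.trans hP.symm)]
    abel
  refine Matrix.PosDef.of_dotProduct_mulVec_pos
    (by rwa [IsHermitian, conjTranspose_eq_transpose_of_trivial]) ?_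
  intro x hx
  simp only [star_trivial]
  obtain ⟨a₀, ha₀, hstep⟩ := exists_step_contract hoff hw hHw
  set K := (twoNorm (P * H) + 1) * twoNorm H
  have hK : 0 ≤ K := mul_nonneg (by have := twoNorm_nonneg (P * H); linarith) (twoNorm_nonneg H)
  obtain ⟨a, ha, haa, haK⟩ : ∃ a : ℝ, 0 < a ∧ a ≤ a₀ ∧ a * K ≤ 1 := by
    refine ⟨min a₀ (1 / (K + 1)), by positivity, min_le_left _ _, ?_⟩
    calc _ ≤ 1 / (K + 1) * K := by gcongr; exact min_le_right _ _
      _ ≤ 1 := by rw [div_mul_eq_mul_div, div_le_one (by positivity)]; linarith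
  obtain ⟨hM, q, hq0, hq, hMw⟩ := hstep a ha haa
  have hxx : ∀ y : Fin N → ℝ, 0 ≤ y ⬝ᵥ y := fun y => Finset.sum_nonneg fun i _ => mul_self_nonneg _
  set V : (Fin N → ℝ) → ℝ := fun y => y ⬝ᵥ (P *ᵥ y) with hV
  have hVcont : Continuous V := by
    simp only [hV]; fun_prop
  have hdec : ∀ y, V ((1 - a • H) *ᵥ y) ≤ V y - a * (y ⬝ᵥ y) := fun y =>
    lyapunov_step hP ha.le haK y
  -- `V` does not increase along the Euler iterates, and these tend to `0`, where `V` vanishes. One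
  -- further step, with its strict decrease, then gives positivity.
  have hnn : ∀ y, 0 ≤ V y := by
    intro y
    have hlim := (hVcont.tendsto 0).comp (tendsto_pow_mulVec hM hw hq0 hq hMw y)
    have hV0 : V 0 = 0 := by simp [hV]
    rw [hV0] at hlim
    refine le_of_tendsto hlim (Filter.Eventually.of_forall fun k => ?_)
    simp only [Function.comp]
    induction k with
    | zero => simp
    | succ k ih =>
      rw [pow_succ', ← mulVec_mulVec]
      refine (hdec _).trans ?_
      have := mul_nonneg ha.le (hxx (((1 - a • H) ^ k) *ᵥ y))
      linarith
  have h1 := hdec x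
  have h2 := hnn ((1 - a • H) *ᵥ x)
  have h3 : 0 < x ⬝ᵥ x := lt_of_le_of_ne (hxx x) fun h => hx (dotProduct_self_eq_zero.1 h.symm)
  have h4 := mul_pos ha h3
  change 0 < V x
  linarith

/-- The Lyapunov operator is an injective endomorphism of a finite-dimensional space. -/
lemma exists_lyapunov (hoff : ∀ i j, i ≠ j → H i j ≤ 0) (hrow : ∀ i, 0 ≤ ∑ j, H i j)
    {w : Fin N → ℝ} (hw : ∀ i, 0 < w i) (hHw : ∀ i, 0 < (H *ᵥ w) i) :
    ∃ P : Matrix (Fin N) (Fin N) ℝ, P * H + Hᵀ * P = (2 : ℝ) • 1 := by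
  let Φ : Matrix (Fin N) (Fin N) ℝ →ₗ[ℝ] Matrix (Fin N) (Fin N) ℝ :=
    LinearMap.mulRight ℝ H + LinearMap.mulLeft ℝ Hᵀ
  have hinj : Function.Injective Φ := by
    rw [← LinearMap.ker_eq_bot, LinearMap.ker_eq_bot']
    exact fun X hX => lyapunov_eq_zero hoff hrow hw hHw hX
  exact LinearMap.surjective_of_injective hinj _

end MMatrix

/-! ### A norm on tuples that Euler steps contract -/

section Gauge

variable {N : ℕ} {E : Type*} [NormedAddCommGroup E] [NormedSpace ℝ E]

/-- The action of a real matrix on tuples of vectors. -/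
def tupleMul (H : Matrix (Fin N) (Fin N) ℝ) (x : Fin N → E) : Fin N → E :=
  fun i => ∑ j, H i j • x j

lemma norm_tupleMul_le (H : Matrix (Fin N) (Fin N) ℝ) (x : Fin N → E) :
    ‖tupleMul H x‖ ≤ (∑ i, ∑ j, |H i j|) * ‖x‖ := by
  have h0 : ∀ i, 0 ≤ ∑ j, |H i j| := fun i => Finset.sum_nonneg fun j _ => abs_nonneg _
  refine (pi_norm_le_iff_of_nonneg
    (mul_nonneg (Finset.sum_nonneg fun i _ => h0 i) (norm_nonneg _))).2 fun i => ?_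
  calc ‖∑ j, H i j • x j‖ ≤ ∑ j, |H i j| * ‖x‖ := by
        refine (norm_sum_le _ _).trans (Finset.sum_le_sum fun j _ => ?_)
        rw [norm_smul, Real.norm_eq_abs]
        gcongr
        exact norm_le_pi_norm x j
    _ = (∑ j, |H i j|) * ‖x‖ := (Finset.sum_mul _ _ _).symm
    _ ≤ _ := by
        exact mul_le_mul_of_nonneg_right (Finset.single_le_sum (f := fun i => ∑ j, |H i j|)
          (fun i _ => h0 i) (Finset.mem_univ i)) (norm_nonneg _)

/-- The Euler step `x ↦ x - a H x` on tuples of vectors of `E` contracts some norm by the factor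
`q`. -/
def StepContracts (E : Type*) [NormedAddCommGroup E] [NormedSpace ℝ E]
    (H : Matrix (Fin N) (Fin N) ℝ) (a q : ℝ) : Prop :=
  ∃ (d : ℕ) (L : (Fin N → E) →L[ℝ] (Fin d → EuclideanSpace ℝ (Fin N))) (C : ℝ), 0 ≤ C ∧
    (∀ x, ‖x‖ ≤ C * ‖L x‖) ∧ ∀ x, ‖L (x - a • tupleMul H x)‖ ≤ q * ‖L x‖

open scoped MatrixOrder Matrix.Norms.L2Operator in
lemma Matrix.PosDef.exists_eq_transpose_mul_self {P : Matrix (Fin N) (Fin N) ℝ} (hP : P.PosDef) :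
    ∃ B : Matrix (Fin N) (Fin N) ℝ, P = Bᵀ * B := by
  obtain ⟨B, hB⟩ := CStarAlgebra.nonneg_iff_eq_star_mul_self.1 hP.posSemidef.nonneg
  exact ⟨B, by simpa [star_eq_conjTranspose] using hB⟩

/-- A short Euler step contracts some norm on the tuples of vectors of a finite-dimensional
space. -/
lemma exists_stepContracts (E : Type*) [NormedAddCommGroup E] [NormedSpace ℝ E]
    [FiniteDimensional ℝ E] {P H : Matrix (Fin N) (Fin N) ℝ}
    (hP : P.PosDef) (hL : P * H + Hᵀ * P = (2 : ℝ) • 1) {a : ℝ} (ha : 0 < a)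
    (ha1 : a * ((twoNorm (P * H) + 1) * twoNorm H) ≤ 1) :
    ∃ q : ℝ, 0 ≤ q ∧ q < 1 ∧ StepContracts E H a q := by
  obtain ⟨B, hB⟩ := hP.exists_eq_transpose_mul_self
  let e : E ≃L[ℝ] (Fin (Module.finrank ℝ E) → ℝ) := ContinuousLinearEquiv.ofFinrankEq (by simp)
  let β : (Fin N → ℝ) →ₗ[ℝ] EuclideanSpace ℝ (Fin N) :=
    (WithLp.linearEquiv 2 ℝ (Fin N → ℝ)).symm.toLinearMap ∘ₗ mulVecLin B
  have hβ : ∀ y, ‖β y‖ ^ 2 = y ⬝ᵥ (P *ᵥ y) := by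
    intro y
    have h1 : ‖β y‖ ^ 2 = (B *ᵥ y) ⬝ᵥ (B *ᵥ y) := by
      rw [EuclideanSpace.norm_sq_eq]
      simp [β, dotProduct, sq]
    rw [h1, hB, ← mulVec_mulVec, dotProduct_mulVec y, vecMul_transpose]
  -- `H` acts on the agent index only, so each coordinate of `E` can be measured separately in the
  -- norm of `P`; the norm of `Λ x` is the maximum over the coordinates.
  let Λ : (Fin N → E) →ₗ[ℝ] (Fin (Module.finrank ℝ E) → EuclideanSpace ℝ (Fin N)) :=
    LinearMap.pi fun c => β ∘ₗ LinearMap.pi fun i =>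
      LinearMap.proj c ∘ₗ e.toLinearEquiv.toLinearMap ∘ₗ LinearMap.proj i
  have hΛ : ∀ x c, Λ x c = β fun i => e (x i) c := fun x c => rfl
  have hxx : ∀ y : Fin N → ℝ, 0 ≤ y ⬝ᵥ y := fun y => Finset.sum_nonneg fun i _ => mul_self_nonneg _
  have hdec : ∀ y, ‖β ((1 - a • H) *ᵥ y)‖ ^ 2 ≤ ‖β y‖ ^ 2 - a * (y ⬝ᵥ y) := fun y => by
    rw [hβ, hβ]
    exact lyapunov_step hL ha.le ha1 y
  -- Adding `a` to the upper bound of the quadratic form ensures `0 < K` and `a / K ≤ 1`, also for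
  -- `N = 0`.
  set K := twoNorm (1 : Matrix (Fin N) (Fin N) ℝ) * twoNorm P + a with hK
  have haK : a ≤ K := by
    have := mul_nonneg (twoNorm_nonneg (1 : Matrix (Fin N) (Fin N) ℝ)) (twoNorm_nonneg P)
    linarith
  have hKpos : 0 < K := ha.trans_le haK
  have hup : ∀ y, ‖β y‖ ^ 2 ≤ K * (y ⬝ᵥ y) := fun y => by
    rw [hβ]
    have h1 := (le_abs_self _).trans (abs_dotProduct_mulVec_le 1 P y)
    rw [one_mulVec] at h1
    nlinarith [mul_nonneg ha.le (hxx y)]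
  have hqq : 0 ≤ 1 - a / K := by rw [sub_nonneg, div_le_one hKpos]; exact haK
  have hβstep : ∀ y, ‖β ((1 - a • H) *ᵥ y)‖ ≤ √(1 - a / K) * ‖β y‖ := by
    intro y
    refine (sq_le_sq₀ (norm_nonneg _) (by positivity)).1 ?_
    rw [mul_pow, Real.sq_sqrt hqq]
    have h1 : a / K * ‖β y‖ ^ 2 ≤ a * (y ⬝ᵥ y) := by
      rw [div_mul_eq_mul_div, div_le_iff₀ hKpos]
      nlinarith [hup y]
    have h2 := hdec y
    linarith
  have hker : LinearMap.ker Λ = ⊥ := by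
    rw [LinearMap.ker_eq_bot']
    intro x hx
    have h1 : ∀ c, (fun i => e (x i) c) = 0 := by
      intro c
      have h2 : β (fun i => e (x i) c) = 0 := by rw [← hΛ, hx]; rfl
      have h3 := hdec fun i => e (x i) c
      rw [h2, norm_zero] at h3
      have h4 := sq_nonneg ‖β ((1 - a • H) *ᵥ fun i => e (x i) c)‖
      refine dotProduct_self_eq_zero.1 (le_antisymm ?_ (hxx _))
      nlinarith
    funext i
    refine e.injective (funext fun c => ?_)
    simpa using congrFun (h1 c) i
  obtain ⟨C, -, hC⟩ := Λ.exists_antilipschitzWith hker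
  refine ⟨√(1 - a / K), Real.sqrt_nonneg _, ?_, _, Λ.toContinuousLinearMap, C, C.2, fun x => ?_,
    fun x => ?_⟩
  · rw [Real.sqrt_lt' one_pos, one_pow]
    have := div_pos ha hKpos
    linarith
  · exact ZeroHomClass.bound_of_antilipschitz Λ hC x
  · refine (pi_norm_le_iff_of_nonneg (mul_nonneg (Real.sqrt_nonneg _) (norm_nonneg _))).2 fun c => ?_
    have h1 : (fun i => e ((x - a • tupleMul H x) i) c)
        = (1 - a • H) *ᵥ fun i => e (x i) c := by
      funext i
      rw [sub_mulVec, one_mulVec, smul_mulVec]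
      simp [tupleMul, mulVec, dotProduct]
    change ‖Λ (x - a • tupleMul H x) c‖ ≤ _
    rw [hΛ, h1]
    refine (hβstep _).trans ?_
    rw [← hΛ]
    gcongr
    exact norm_le_pi_norm (Λ x) c

end Gauge

/-! ### Perturbed contractions -/

section Recursion

/-- A contraction perturbed by geometrically small terms decays geometrically. -/
lemma exists_le_mul_pow {y : ℕ → ℝ} (hy : ∀ k, 0 ≤ y k) {q ρ C : ℝ} (hq : 0 ≤ q) (hqρ : q < ρ)
    (hρ : ρ < 1) (hC : 0 ≤ C) (h : ∀ k, y (k + 1) ≤ q * y k + C * ρ ^ k * (1 + y k)) :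
    ∃ D, 0 ≤ D ∧ ∀ k, y k ≤ D * ρ ^ k := by
  have hρ0 : 0 < ρ := hq.trans_lt hqρ
  have h1ρ : 0 < 1 - ρ := sub_pos.2 hρ
  -- Boundedness comes first: `1 + y k` grows at most by the factors `1 + C * ρ ^ k`, whose product
  -- is bounded by the exponential of a geometric sum.
  have hb : ∀ k, 1 + y k ≤ (1 + y 0) * Real.exp (C * ((1 - ρ ^ k) / (1 - ρ))) := by
    intro k
    induction k with
    | zero => simp
    | succ k ih =>
      have hk : 0 < ρ ^ k := pow_pos hρ0 k
      have e1 : C * ((1 - ρ ^ (k + 1)) / (1 - ρ)) = C * ρ ^ k + C * ((1 - ρ ^ k) / (1 - ρ)) := by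
        field_simp
        ring
      rw [e1, Real.exp_add]
      calc 1 + y (k + 1) ≤ (C * ρ ^ k + 1) * (1 + y k) := by nlinarith [h k, hy k]
        _ ≤ Real.exp (C * ρ ^ k) * ((1 + y 0) * Real.exp (C * ((1 - ρ ^ k) / (1 - ρ)))) := by
            refine mul_le_mul (Real.add_one_le_exp _) ih ?_ (Real.exp_nonneg _)
            linarith [hy k]
        _ = _ := by ring
  set Y := (1 + y 0) * Real.exp (C * (1 / (1 - ρ))) with hYdef
  have hY : ∀ k, 1 + y k ≤ Y := fun k => by
    refine (hb k).trans ?_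
    have := hy 0
    rw [hYdef]
    gcongr
    linarith [pow_pos hρ0 k]
  have hY0 : 0 ≤ Y := le_trans (by linarith [hy 0]) (hY 0)
  have hCY : 0 ≤ C * Y / (ρ - q) := div_nonneg (mul_nonneg hC hY0) (sub_pos.2 hqρ).le
  -- `A = C * Y / (ρ - q)` is the solution of `q * A + C * Y = ρ * A`, which closes the induction.
  refine ⟨y 0 + C * Y / (ρ - q), add_nonneg (hy 0) hCY, fun k => ?_⟩
  induction k with
  | zero => simpa using hCY
  | succ k ih =>
    have hk : 0 < ρ ^ k := pow_pos hρ0 k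
    have h1 : C * Y = C * Y / (ρ - q) * (ρ - q) := (div_mul_cancel₀ _ (sub_pos.2 hqρ).ne').symm
    calc y (k + 1) ≤ q * y k + C * ρ ^ k * (1 + y k) := h k
      _ ≤ q * ((y 0 + C * Y / (ρ - q)) * ρ ^ k) + C * ρ ^ k * Y := by
          gcongr
          exact hY k
      _ = (q * y 0 + (C * Y / (ρ - q) * q + C * Y)) * ρ ^ k := by ring
      _ ≤ (ρ * y 0 + C * Y / (ρ - q) * ρ) * ρ ^ k := by
          refine mul_le_mul_of_nonneg_right ?_ hk.le
          nlinarith [hy 0]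
      _ = _ := by ring

variable {N : ℕ} {E : Type*} [NormedAddCommGroup E] [NormedSpace ℝ E]

/-- Exponential decay of a sampled consensus system with geometrically small perturbations. -/
lemma exists_decay_bound {H : Matrix (Fin N) (Fin N) ℝ} {μ T q ρ C : ℝ} (hμ : 0 ≤ μ) (hT : 0 ≤ T)
    (hq : 0 ≤ q) (hqρ : q < ρ) (hρ : ρ < 1) (hH : StepContracts E H (μ * T) q) (hC : 0 ≤ C) {x : ℝ → Fin N → E}
    (hx : ∀ k : ℕ, ∀ t ∈ Icc ((k : ℝ) * T) (((k + 1 : ℕ) : ℝ) * T),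
      ‖x t - x (k * T) + (μ * (t - k * T)) • tupleMul H (x (k * T))‖
        ≤ C * ρ ^ k * (1 + ‖x (k * T)‖)) :
    ∃ D, 0 ≤ D ∧ ∀ k : ℕ, ∀ t ∈ Icc ((k : ℝ) * T) (((k + 1 : ℕ) : ℝ) * T), ‖x t‖ ≤ D * ρ ^ k := by
  obtain ⟨d, L, c, hc, hLc, hLq⟩ := hH
  have hρ0 : 0 < ρ := hq.trans_lt hqρ
  obtain ⟨D, hD, hy⟩ := exists_le_mul_pow (y := fun k => ‖L (x (k * T))‖)
      (C := ‖L‖ * C * (1 + c)) (fun k => norm_nonneg _) hq hqρ hρ (by positivity) (by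
    intro k
    -- At the right end of the interval the hypothesis describes a full Euler step of length `μ *
    -- T`, which `L` contracts.
    have h1 := hx k (((k + 1 : ℕ) : ℝ) * T) ⟨by push_cast; nlinarith, le_rfl⟩
    set X := x (k * T)
    set Y := x (((k + 1 : ℕ) : ℝ) * T)
    have h2 : ((k + 1 : ℕ) : ℝ) * T - k * T = T := by push_cast; ring
    rw [h2] at h1
    have h3 : Y = (X - (μ * T) • tupleMul H X) + (Y - X + (μ * T) • tupleMul H X) := by abel
    change ‖L Y‖ ≤ q * ‖L X‖ + ‖L‖ * C * (1 + c) * ρ ^ k * (1 + ‖L X‖)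
    rw [h3, map_add]
    refine (norm_add_le _ _).trans (add_le_add (hLq X) ?_)
    calc _ ≤ ‖L‖ * (C * ρ ^ k * (1 + ‖X‖)) := (L.le_opNorm _).trans (by gcongr)
      _ ≤ ‖L‖ * (C * ρ ^ k * ((1 + c) * (1 + ‖L X‖))) := by
          gcongr
          nlinarith [hLc X, norm_nonneg (L X)]
      _ = _ := by ring)
  set K := ∑ i, ∑ j, |H i j|
  have hK : 0 ≤ K := Finset.sum_nonneg fun i _ => Finset.sum_nonneg fun j _ => abs_nonneg _
  refine ⟨c * D + (μ * T) * (K * (c * D)) + C * (1 + c * D), by positivity, fun k t ht => ?_⟩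
  have hk : 0 < ρ ^ k := pow_pos hρ0 k
  have hk1 : ρ ^ k ≤ 1 := pow_le_one₀ hρ0.le hρ.le
  have h1 := hx k t ht
  set X := x (k * T) with hX
  have hXb : ‖X‖ ≤ c * D * ρ ^ k := by
    have := mul_le_mul_of_nonneg_left (hy k) hc
    have h2 := hLc X
    nlinarith
  have hXb1 : ‖X‖ ≤ c * D := hXb.trans (mul_le_of_le_one_right (by positivity) hk1)
  have ht0 : 0 ≤ t - k * T := sub_nonneg.2 ht.1
  have htT : t - k * T ≤ T := by
    have := ht.2
    push_cast at this
    linarith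
  have h3 : x t = X - (μ * (t - k * T)) • tupleMul H X
      + (x t - X + (μ * (t - k * T)) • tupleMul H X) := by abel
  rw [h3]
  calc _ ≤ ‖X‖ + ‖(μ * (t - k * T)) • tupleMul H X‖ + C * ρ ^ k * (1 + ‖X‖) :=
        (norm_add_le _ _).trans (add_le_add (norm_sub_le _ _) h1)
    _ ≤ c * D * ρ ^ k + (μ * T) * (K * (c * D * ρ ^ k)) + C * ρ ^ k * (1 + c * D) := by
        rw [norm_smul, Real.norm_of_nonneg (mul_nonneg hμ ht0)]
        gcongr
        exact (norm_tupleMul_le H X).trans (by gcongr)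
    _ = _ := by ring

end Recursion

/-! ### Matrix exponentials and boundedness of neutrally stable flows -/

section MatrixExp

/-- The flow `e^{tA}` of the linear system `x' = A x`. -/
def matrixFlow {𝕜 : Type*} [RCLike 𝕜] {n : ℕ} (A : Matrix (Fin n) (Fin n) 𝕜) (t : ℝ) :
    Matrix (Fin n) (Fin n) 𝕜 :=
  NormedSpace.exp (t • A)

open scoped Matrix.Norms.Operator

variable {n : ℕ}

lemma HasDerivWithinAt.matrix_mulVec {A : ℝ → Matrix (Fin n) (Fin n) ℝ} {v : ℝ → Fin n → ℝ}
    {A' : Matrix (Fin n) (Fin n) ℝ} {v' : Fin n → ℝ} {s : Set ℝ} {t : ℝ}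
    (hA : HasDerivWithinAt A A' s t) (hv : HasDerivWithinAt v v' s t) :
    HasDerivWithinAt (fun t => A t *ᵥ v t) (A' *ᵥ v t + A t *ᵥ v') s t := by
  rw [hasDerivWithinAt_pi] at hv ⊢
  have hA2 : ∀ i j, HasDerivWithinAt (fun t => A t i j) (A' i j) s t := fun i j =>
    (hasDerivWithinAt_pi.1 (hasDerivWithinAt_pi.1 hA i)) j
  intro i
  have := HasDerivWithinAt.fun_sum (u := Finset.univ) fun j _ => (hA2 i j).mul (hv j)
  simpa [mulVec, dotProduct, Finset.sum_add_distrib] using this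

lemma hasDerivAt_matrixFlow (A : Matrix (Fin n) (Fin n) ℝ) (t : ℝ) :
    HasDerivAt (matrixFlow A) (A * matrixFlow A t) t :=
  hasDerivAt_exp_smul_const' A t

lemma continuous_matrixFlow (A : Matrix (Fin n) (Fin n) ℝ) : Continuous (matrixFlow A) :=
  continuous_iff_continuousAt.2 fun t => (hasDerivAt_matrixFlow A t).continuousAt

lemma matrixFlow_add (A : Matrix (Fin n) (Fin n) ℝ) (s t : ℝ) :
    matrixFlow A (s + t) = matrixFlow A s * matrixFlow A t := by
  unfold matrixFlow
  rw [add_smul]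
  exact Matrix.exp_add_of_commute _ _ (((Commute.refl A).smul_left s).smul_right t)

lemma matrixFlow_zero (A : Matrix (Fin n) (Fin n) ℝ) : matrixFlow A 0 = 1 := by
  unfold matrixFlow
  rw [zero_smul]
  exact NormedSpace.exp_zero

lemma matrixFlow_mul_neg (A : Matrix (Fin n) (Fin n) ℝ) (t : ℝ) :
    matrixFlow A t * matrixFlow A (-t) = 1 := by
  rw [← matrixFlow_add, add_neg_cancel, matrixFlow_zero]

lemma matrixFlow_neg_mul (A : Matrix (Fin n) (Fin n) ℝ) (t : ℝ) :
    matrixFlow A (-t) * matrixFlow A t = 1 := by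
  rw [← matrixFlow_add, neg_add_cancel, matrixFlow_zero]

lemma matrixFlow_comm (A : Matrix (Fin n) (Fin n) ℝ) (t : ℝ) :
    matrixFlow A t * A = A * matrixFlow A t :=
  (Commute.exp_right ((Commute.refl A).smul_right t)).eq.symm

lemma matrixFlow_mulVec_of_eigenvector {A : Matrix (Fin n) (Fin n) ℂ} {z : ℂ} {x : Fin n → ℂ}
    (hx : A *ᵥ x = z • x) (t : ℝ) :
    matrixFlow A t *ᵥ x = Complex.exp (t * z) • x := by
  have hpow : ∀ k : ℕ, ((t • A) ^ k) *ᵥ x = (t * z) ^ k • x := by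
    intro k
    induction k with
    | zero => simp
    | succ k ih =>
      rw [pow_succ, ← mulVec_mulVec, smul_mulVec, hx, mulVec_smul, mulVec_smul, ih, smul_smul,
        pow_succ', ← smul_assoc]
      congr 1
      simp [mul_assoc]
  have h1 := (NormedSpace.exp_series_hasSum_exp' (𝕂 := ℂ) (t • A))
  let φ : Matrix (Fin n) (Fin n) ℂ →+ (Fin n → ℂ) :=
    { toFun := fun M => M *ᵥ x, map_zero' := zero_mulVec x, map_add' := fun M M' => add_mulVec M M' x }
  have hφ : Continuous φ := by
    change Continuous fun M : Matrix (Fin n) (Fin n) ℂ => M *ᵥ x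
    fun_prop
  have h2 := h1.map φ hφ
  have h3 := ((NormedSpace.exp_series_hasSum_exp' (𝕂 := ℂ) (t * z : ℂ))).smul_const x
  rw [Complex.exp_eq_exp_ℂ]
  refine h2.unique ?_
  convert h3 using 1
  funext k
  change (((k.factorial : ℂ)⁻¹) • (t • A) ^ k) *ᵥ x = _
  rw [smul_mulVec, hpow, smul_assoc]

lemma linfty_opNorm_le {A : Matrix (Fin n) (Fin n) ℝ} {c : ℝ} (hc : 0 ≤ c)
    (h : ∀ i, ∑ j, |A i j| ≤ c) : ‖A‖ ≤ c := by
  lift c to NNReal using hc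
  rw [Matrix.linfty_opNorm_def, NNReal.coe_le_coe]
  refine Finset.sup_le fun i _ => ?_
  rw [← NNReal.coe_le_coe]
  simpa using h i

lemma abs_apply_le_linfty_opNorm (A : Matrix (Fin n) (Fin n) ℝ) (i j : Fin n) : |A i j| ≤ ‖A‖ := by
  have h1 : ∑ j, ‖A i j‖₊ ≤ Finset.univ.sup fun i => ∑ j, ‖A i j‖₊ :=
    Finset.le_sup (f := fun i => ∑ j, ‖A i j‖₊) (Finset.mem_univ i)
  have h2 : ‖A i j‖₊ ≤ ∑ j, ‖A i j‖₊ :=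
    Finset.single_le_sum (f := fun j => ‖A i j‖₊) (fun _ _ => zero_le) (Finset.mem_univ j)
  rw [Matrix.linfty_opNorm_def, ← Real.norm_eq_abs, ← coe_nnnorm, NNReal.coe_le_coe]
  exact h2.trans h1

lemma norm_le_card_mul_frobNorm (A : Matrix (Fin n) (Fin n) ℝ) : ‖A‖ ≤ n * frobNorm A := by
  have h0 : ∀ i j, |A i j| ≤ frobNorm A := fun i j => by
    refine Real.le_sqrt_of_sq_le ?_
    rw [sq_abs]
    exact (Finset.single_le_sum (f := fun j => A i j ^ 2) (fun _ _ => sq_nonneg _)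
      (Finset.mem_univ j)).trans (Finset.single_le_sum (f := fun i => ∑ j, A i j ^ 2)
        (fun i _ => Finset.sum_nonneg fun _ _ => sq_nonneg _) (Finset.mem_univ i))
  refine linfty_opNorm_le (mul_nonneg (Nat.cast_nonneg _) (Real.sqrt_nonneg _)) fun i => ?_
  refine (Finset.sum_le_sum fun j _ => h0 i j).trans ?_
  simp

lemma frobNorm_le_card_mul_norm (A : Matrix (Fin n) (Fin n) ℝ) : frobNorm A ≤ n * ‖A‖ := by
  refine Real.sqrt_le_iff.2 ⟨by positivity, ?_⟩
  have h1 : ∀ i j, A i j ^ 2 ≤ ‖A‖ ^ 2 := fun i j =>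
    sq_le_sq' (neg_le_of_abs_le (abs_apply_le_linfty_opNorm A i j))
      ((le_abs_self _).trans (abs_apply_le_linfty_opNorm A i j))
  refine (Finset.sum_le_sum fun i _ => Finset.sum_le_sum fun j _ => h1 i j).trans ?_
  simp only [Finset.sum_const, Finset.card_univ, Fintype.card_fin, nsmul_eq_mul]
  exact le_of_eq (by ring)

lemma norm_le_eucNorm (x : Fin n → ℝ) : ‖x‖ ≤ eucNorm x :=
  (pi_norm_le_iff_of_nonneg (norm_nonneg _)).2 fun i =>
    PiLp.norm_apply_le (WithLp.toLp 2 x : EuclideanSpace ℝ (Fin n)) i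

lemma eucNorm_le_card_mul_norm (x : Fin n → ℝ) : eucNorm x ≤ n * ‖x‖ := by
  unfold eucNorm
  rw [EuclideanSpace.norm_eq]
  rcases Nat.eq_zero_or_pos n with rfl | hn
  · simp
  refine Real.sqrt_le_iff.2 ⟨by positivity, ?_⟩
  have h1 : ∀ i, ‖(WithLp.toLp 2 x : EuclideanSpace ℝ (Fin n)) i‖ ^ 2 ≤ ‖x‖ ^ 2 := fun i =>
    pow_le_pow_left₀ (norm_nonneg _) (norm_le_pi_norm x i) 2
  refine (Finset.sum_le_sum fun i _ => h1 i).trans ?_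
  simp only [Finset.sum_const, Finset.card_univ, Fintype.card_fin, nsmul_eq_mul]
  have h2 : (1 : ℝ) ≤ n := by exact_mod_cast hn
  nlinarith [mul_nonneg (Nat.cast_nonneg n : (0 : ℝ) ≤ n) (sq_nonneg ‖x‖)]

lemma map_matrixFlow (S : Matrix (Fin n) (Fin n) ℝ) (t : ℝ) :
    (matrixFlow S t).map (algebraMap ℝ ℂ) = matrixFlow (S.map (algebraMap ℝ ℂ)) t := by
  refine (NormedSpace.map_exp ((algebraMap ℝ ℂ).mapMatrix (m := Fin n)) ?_ (t • S)).trans ?_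
  · change Continuous fun M : Matrix (Fin n) (Fin n) ℝ => M.map (algebraMap ℝ ℂ)
    exact continuous_id.matrix_map Complex.continuous_ofReal
  · have : (algebraMap ℝ ℂ).mapMatrix (t • S) = t • S.map (algebraMap ℝ ℂ) := by
      ext i j
      simp
    rw [this]
    rfl

lemma maxGenEigenspace_eq_bot {K V : Type*} [Field K] [AddCommGroup V] [Module K V]
    {f : Module.End K V} {z : K} (hz : ¬ f.HasEigenvalue z) : f.maxGenEigenspace z = ⊥ := by
  by_contra hne
  exact hz (Module.End.HasUnifEigenvalue.lt zero_lt_one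
    (show Module.End.HasUnifEigenvalue f z ⊤ from hne))

/-- The vectors along which the flow of a complex matrix is bounded. -/
def boundedFlow (A : Matrix (Fin n) (Fin n) ℂ) : Submodule ℂ (Fin n → ℂ) where
  carrier := {x | ∃ b : ℝ, ∀ t : ℝ, ‖matrixFlow A t *ᵥ x‖ ≤ b}
  zero_mem' := ⟨0, fun t => by simp⟩
  add_mem' := by
    rintro x y ⟨b, hb⟩ ⟨c, hc⟩
    exact ⟨b + c, fun t => by
      rw [mulVec_add]; exact (norm_add_le _ _).trans (add_le_add (hb t) (hc t))⟩
  smul_mem' := by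
    rintro z x ⟨b, hb⟩
    exact ⟨‖z‖ * b, fun t => by
      rw [mulVec_smul, norm_smul]; exact mul_le_mul_of_nonneg_left (hb t) (norm_nonneg _)⟩

/-- Over `ℂ` the generalized eigenspaces span. Semi-simplicity makes them eigenspaces, on which the
flow is multiplication by `e^{tz}`, of modulus `1`. -/
lemma NeutrallyStable.boundedFlow_eq_top {S : Matrix (Fin n) (Fin n) ℝ} (hS : NeutrallyStable S) :
    boundedFlow (S.map (algebraMap ℝ ℂ)) = ⊤ := by
  rw [eq_top_iff, ← Module.End.iSup_maxGenEigenspace_eq_top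
    (Matrix.toLin' (S.map (algebraMap ℝ ℂ))), iSup_le_iff]
  intro z
  by_cases hz : Module.End.HasEigenvalue (Matrix.toLin' (S.map (algebraMap ℝ ℂ))) z
  · obtain ⟨hre, hss⟩ := hS z hz
    rw [hss]
    intro x hx
    rw [Module.End.mem_eigenspace_iff, Matrix.toLin'_apply] at hx
    refine ⟨‖x‖, fun t => ?_⟩
    rw [matrixFlow_mulVec_of_eigenvector hx, norm_smul, Complex.norm_exp]
    simp [hre]
  · rw [maxGenEigenspace_eq_bot hz]
    exact bot_le

/-- The flow of a neutrally stable linear system is bounded on the whole line. -/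
lemma NeutrallyStable.exists_matrixFlow_bound {S : Matrix (Fin n) (Fin n) ℝ} (hS : NeutrallyStable S) :
    ∃ B : ℝ, 0 ≤ B ∧ ∀ t : ℝ, ‖matrixFlow S t‖ ≤ B := by
  have hcol : ∀ j, ∃ b : ℝ, ∀ t : ℝ, ∀ i, |matrixFlow S t i j| ≤ b := by
    intro j
    obtain ⟨b, hb⟩ : (Pi.single j 1 : Fin n → ℂ) ∈ boundedFlow (S.map (algebraMap ℝ ℂ)) := by
      rw [hS.boundedFlow_eq_top]; trivial
    refine ⟨b, fun t i => ?_⟩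
    have h1 := (norm_le_pi_norm _ i).trans (hb t)
    rw [← map_matrixFlow] at h1
    simpa using h1
  choose b hb using hcol
  have hb0 : ∀ j, 0 ≤ b j := fun j => (abs_nonneg _).trans (hb j 0 j)
  exact ⟨∑ j, b j, Finset.sum_nonneg fun j _ => hb0 j, fun t =>
    linfty_opNorm_le (Finset.sum_nonneg fun j _ => hb0 j) fun i =>
      Finset.sum_le_sum fun j _ => hb j t i⟩

end MatrixExp

/-! ### Grönwall estimates over one sampling interval -/

section Gronwall

variable {E : Type*} [NormedAddCommGroup E] [NormedSpace ℝ E]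

/-- The displacement must be linear in `δ`, which will decay with the interval, while the
exponential factor uses only the uniform bound `δ₀`. -/
lemma norm_sub_le_of_norm_deriv_le_mul {z z' : ℝ → E} {a b δ δ₀ : ℝ}
    (hz : ContinuousOn z (Icc a b)) (hz' : ∀ t ∈ Ico a b, HasDerivWithinAt z (z' t) (Ici t) t)
    (hδ : 0 ≤ δ) (hδ₀ : δ ≤ δ₀) (hb : ∀ t ∈ Ico a b, ‖z' t‖ ≤ δ * ‖z t‖) {t : ℝ}
    (ht : t ∈ Icc a b) :
    ‖z t - z a‖ ≤ δ * (Real.exp (δ₀ * (b - a)) * ‖z a‖) * (b - a) := by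
  have hδ₀' : 0 ≤ δ₀ := hδ.trans hδ₀
  have hgr : ∀ s ∈ Icc a b, ‖z s‖ ≤ Real.exp (δ₀ * (b - a)) * ‖z a‖ := by
    intro s hs
    have h1 := norm_le_gronwallBound_of_norm_deriv_right_le (ε := 0) hz hz' le_rfl
      (fun t ht => by rw [add_zero]; exact hb t ht) s hs
    rw [gronwallBound_ε0, mul_comm] at h1
    refine h1.trans ?_
    have h2 : 0 ≤ s - a := sub_nonneg.2 hs.1
    have h3 : s ≤ b := hs.2
    gcongr
  have h1 := norm_image_sub_le_of_norm_deriv_right_le_segment hz hz'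
    (C := δ * (Real.exp (δ₀ * (b - a)) * ‖z a‖)) (fun s hs => (hb s hs).trans (by
      gcongr
      exact hgr s ⟨hs.1, hs.2.le⟩)) t ht
  refine h1.trans ?_
  have h3 : t ≤ b := ht.2
  gcongr

lemma gronwallBound_le {δ K ε x : ℝ} (hK : 1 ≤ K) (hε : 0 ≤ ε) (hx : 0 ≤ x) :
    gronwallBound δ K ε x ≤ (δ + ε) * Real.exp (K * x) := by
  rw [gronwallBound_of_K_ne_0 (by positivity)]
  have h1 : ε / K ≤ ε := div_le_self hε hK
  have h2 : 1 ≤ Real.exp (K * x) := Real.one_le_exp (by positivity)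
  have h3 : ε / K * (Real.exp (K * x) - 1) ≤ ε * Real.exp (K * x) :=
    mul_le_mul h1 (by linarith) (by linarith) hε
  simp only
  linarith

/-- A nearly constant drift moves a point nearly uniformly. -/
lemma norm_sub_sub_smul_le {f g w : ℝ → E} {a b δ δ₀ c η : ℝ} {w₀ : E}
    (hf : ContinuousOn f (Icc a b)) (hf' : ∀ t ∈ Ico a b, HasDerivWithinAt f (g t + w t) (Ici t) t)
    (hδ : 0 ≤ δ) (hδ₀ : δ ≤ δ₀) (hc : 0 ≤ c) (hη : 0 ≤ η)
    (hg : ∀ t ∈ Ico a b, ‖g t‖ ≤ δ * (‖f t‖ + c)) (hw : ∀ t ∈ Ico a b, ‖w t - w₀‖ ≤ η)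
    {t : ℝ} (ht : t ∈ Icc a b) :
    ‖f t - f a - (t - a) • w₀‖ ≤ (δ * ((‖f a‖ + (δ₀ * c + ‖w₀‖ + η)) *
      Real.exp ((δ₀ + 1) * (b - a)) + c) + η) * (b - a) := by
  have hδ₀' : 0 ≤ δ₀ := hδ.trans hδ₀
  set R := (‖f a‖ + (δ₀ * c + ‖w₀‖ + η)) * Real.exp ((δ₀ + 1) * (b - a))
  have hgr : ∀ s ∈ Icc a b, ‖f s‖ ≤ R := by
    intro s hs
    -- The rate is `δ₀ + 1` because `gronwallBound_le` needs a rate of at least `1`.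
    have h1 := norm_le_gronwallBound_of_norm_deriv_right_le (K := δ₀ + 1)
      (ε := δ₀ * c + ‖w₀‖ + η) hf hf' le_rfl (fun t ht => by
        have h2 := (hg t ht).trans (mul_le_mul_of_nonneg_right hδ₀ (by positivity))
        have h3 := norm_add_le (g t) (w t)
        have h4 : ‖w t‖ ≤ η + ‖w₀‖ := by
          have := norm_add_le (w t - w₀) w₀
          rw [sub_add_cancel] at this
          linarith [hw t ht]
        nlinarith [norm_nonneg (f t)]) s hs
    have h2 : 0 ≤ s - a := sub_nonneg.2 hs.1
    refine (h1.trans (gronwallBound_le (by linarith) (by positivity) h2)).trans ?_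
    exact mul_le_mul_of_nonneg_left (Real.exp_le_exp.2 (mul_le_mul_of_nonneg_left
      (sub_le_sub_right hs.2 a) (by positivity))) (by positivity)
  have hR : 0 ≤ R := (norm_nonneg _).trans (hgr t ht)
  have hlin : ∀ s, HasDerivAt (fun s => (s - a) • w₀) w₀ s := fun s => by
    simpa using ((hasDerivAt_id s).sub_const a).smul_const w₀
  have h1 := norm_image_sub_le_of_norm_deriv_right_le_segment
    (f := fun s => f s - (s - a) • w₀) (f' := fun s => g s + w s - w₀) (C := δ * (R + c) + η)
    (hf.sub (by fun_prop)) (fun s hs => (hf' s hs).sub (hlin s).hasDerivWithinAt) (fun s hs => by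
      have h2 := hg s hs
      have h3 := hgr s ⟨hs.1, hs.2.le⟩
      have h4 : δ * (‖f s‖ + c) ≤ δ * (R + c) := by gcongr
      rw [add_sub_assoc]
      exact (norm_add_le _ _).trans (by linarith [hw s hs])) t ht
  have h5 : f t - f a - (t - a) • w₀ = f t - (t - a) • w₀ - (f a - (a - a) • w₀) := by
    rw [sub_self, zero_smul, sub_zero]; abel
  rw [h5]
  refine h1.trans ?_
  have h6 : t ≤ b := ht.2
  gcongr

end Gronwall

/-! ### Event times and triggering thresholds -/

section Events

variable {n : ℕ} (p : PETParams) (Sh : ℝ → Matrix (Fin n) (Fin n) ℝ) (vh : ℝ → Fin n → ℝ)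

lemma exists_latestEvent_eq (k : ℕ) : ∃ m ≤ k, latestEvent p Sh vh k = m * p.T := by
  induction k with
  | zero => exact ⟨0, le_rfl, by simp [latestEvent]⟩
  | succ k ih =>
    rw [latestEvent]
    split_ifs
    · exact ⟨k + 1, le_rfl, rfl⟩
    · obtain ⟨m, hm, h⟩ := ih
      exact ⟨m, hm.trans k.le_succ, h⟩

lemma latestEvent_nonneg (k : ℕ) : 0 ≤ latestEvent p Sh vh k := by
  obtain ⟨m, -, h⟩ := exists_latestEvent_eq p Sh vh k
  rw [h]
  exact mul_nonneg (Nat.cast_nonneg _) p.T_pos.le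

lemma latestEvent_le (k : ℕ) : latestEvent p Sh vh k ≤ k * p.T := by
  obtain ⟨m, hm, h⟩ := exists_latestEvent_eq p Sh vh k
  rw [h]
  have := p.T_pos.le
  gcongr

lemma vbar_eq (s t : ℝ) : vbar Sh vh s t = matrixFlow (Sh s) (t - s) *ᵥ vh s := rfl

lemma vbar_self (s : ℝ) : vbar Sh vh s s = vh s := by
  rw [vbar_eq, sub_self, matrixFlow_zero, one_mulVec]

lemma frobNorm_zero : frobNorm (0 : Matrix (Fin n) (Fin n) ℝ) = 0 := by simp [frobNorm]

lemma eucNorm_zero : eucNorm (0 : Fin n → ℝ) = 0 := by simp [eucNorm]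

/-- Just after a sampling instant no triggering function is positive. -/
lemma trig_latestEvent_nonpos (k : ℕ) :
    trigS p Sh (k * p.T) (latestEvent p Sh vh k) ≤ 0 ∧
      trigV p Sh vh (k * p.T) (latestEvent p Sh vh k) ≤ 0 := by
  have hself : ∀ s, trigS p Sh s s ≤ 0 ∧ trigV p Sh vh s s ≤ 0 := fun s => by
    have h1 := mul_pos p.ιS_pos (Real.exp_pos (-p.γS * s))
    have h2 := mul_pos p.ιv_pos (Real.exp_pos (-p.γv * s))
    rw [trigS, trigV, sub_self, frobNorm_zero, vbar_self, sub_self, eucNorm_zero]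
    constructor <;> linarith
  cases k with
  | zero => simpa [latestEvent] using hself 0
  | succ k =>
    rw [latestEvent]
    split_ifs with h
    · exact hself _
    · exact ⟨not_lt.1 fun h1 => h (Or.inl h1), not_lt.1 fun h1 => h (Or.inr h1)⟩

open scoped Matrix.Norms.Operator in
lemma norm_sub_latestEvent_le (k : ℕ) : ‖Sh (k * p.T) - Sh (latestEvent p Sh vh k)‖
    ≤ n * p.ιS * Real.exp (-p.γS * (k * p.T)) := by
  have h1 := (trig_latestEvent_nonpos p Sh vh k).1
  rw [trigS, sub_nonpos] at h1
  refine (norm_le_card_mul_frobNorm _).trans ?_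
  rw [mul_assoc]
  gcongr

lemma norm_sub_vbar_latestEvent_le (k : ℕ) :
    ‖vh (k * p.T) - vbar Sh vh (latestEvent p Sh vh k) (k * p.T)‖
      ≤ p.ιv * Real.exp (-p.γv * (k * p.T)) := by
  have h1 := (trig_latestEvent_nonpos p Sh vh k).2
  rw [trigV, sub_nonpos] at h1
  exact (norm_le_eucNorm _).trans h1

end Events

/-! ### The frame moving with the leader -/

section Frame

open scoped Matrix.Norms.Operator

variable {n : ℕ}

lemma norm_matrixFlow_mulVec_le {S : Matrix (Fin n) (Fin n) ℝ} {B : ℝ}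
    (hB : ∀ t, ‖matrixFlow S t‖ ≤ B) (t : ℝ) (x : Fin n → ℝ) :
    ‖matrixFlow S t *ᵥ x‖ ≤ B * ‖x‖ :=
  (Matrix.linfty_opNorm_mulVec _ _).trans (mul_le_mul_of_nonneg_right (hB t) (norm_nonneg _))

/-- Passing to the frame that moves with the flow of `S`. -/
lemma HasDerivWithinAt.matrixFlow_neg_mulVec (S : Matrix (Fin n) (Fin n) ℝ)
    {A : Matrix (Fin n) (Fin n) ℝ} {u : ℝ → Fin n → ℝ} {g : Fin n → ℝ} {s : Set ℝ} {t : ℝ}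
    (hu : HasDerivWithinAt u (A *ᵥ u t + g) s t) :
    HasDerivWithinAt (fun t => matrixFlow S (-t) *ᵥ u t)
      (matrixFlow S (-t) *ᵥ ((A - S) *ᵥ u t) + matrixFlow S (-t) *ᵥ g) s t := by
  have h1 : HasDerivAt (fun t => matrixFlow S (-t)) (-(S * matrixFlow S (-t))) t :=
    ((hasDerivAt_matrixFlow S (-t)).scomp t (hasDerivAt_neg t)).congr_deriv (neg_one_smul ℝ _)
  convert (HasDerivWithinAt.matrix_mulVec h1.hasDerivWithinAt hu) using 1
  -- `S` commutes with its flow, so the derivative of the frame subtracts `S` from `A`.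
  rw [← matrixFlow_comm, neg_mulVec, ← mulVec_mulVec, sub_mulVec, mulVec_sub, mulVec_add]
  abel

lemma hasDerivAt_vbar (Sh : ℝ → Matrix (Fin n) (Fin n) ℝ) (vh : ℝ → Fin n → ℝ) (s t : ℝ) :
    HasDerivAt (vbar Sh vh s) (Sh s *ᵥ vbar Sh vh s t) t := by
  have h1 : HasDerivAt (fun t => matrixFlow (Sh s) (t - s))
      (Sh s * matrixFlow (Sh s) (t - s)) t :=
    HasDerivAt.comp_sub_const t s (hasDerivAt_matrixFlow (Sh s) (t - s))
  have h2 := HasDerivWithinAt.matrix_mulVec h1.hasDerivWithinAt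
    (hasDerivWithinAt_const t univ (vh s))
  rw [hasDerivWithinAt_univ, mulVec_zero, add_zero, ← mulVec_mulVec] at h2
  exact h2

lemma IsLeaderTrajectory.eq_matrixFlow_mulVec {S : Matrix (Fin n) (Fin n) ℝ} {v : ℝ → Fin n → ℝ}
    (hv : IsLeaderTrajectory S v) {t : ℝ} (ht : 0 ≤ t) : v t = matrixFlow S t *ᵥ v 0 := by
  have hd : ∀ s, 0 ≤ s → HasDerivWithinAt (fun t => matrixFlow S (-t) *ᵥ v t) 0 (Ici 0) s := by
    intro s hs
    have h1 := HasDerivWithinAt.matrixFlow_neg_mulVec S (A := S) (g := 0) (by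
      rw [add_zero]; exact hv s hs)
    simpa using h1
  have h1 := constant_of_has_deriv_right_zero (a := 0) (b := t)
    (fun s hs => (hd s hs.1).continuousWithinAt.mono fun r hr => hr.1)
    (fun s hs => (hd s hs.1).mono fun r hr => hs.1.trans hr) t ⟨ht, le_rfl⟩
  simp only [neg_zero, matrixFlow_zero, one_mulVec] at h1
  rw [← h1, mulVec_mulVec, matrixFlow_mul_neg, one_mulVec]

end Frame

/-! ### Geometric decay of the estimation errors -/

section Decay

open scoped Matrix.Norms.Operator

variable {N n : ℕ} {G : Digraph (Fin (N + 1))} {p : PETParams} {S : Matrix (Fin n) (Fin n) ℝ}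
  {v : ℝ → Fin n → ℝ} {Sh : Fin (N + 1) → ℝ → Matrix (Fin n) (Fin n) ℝ}
  {vh : Fin (N + 1) → ℝ → Fin n → ℝ}

lemma HasDerivWithinAt.of_samplingInterval {E : Type*} [NormedAddCommGroup E] [NormedSpace ℝ E]
    {f : ℝ → E} {f' : E} {k : ℕ} {t : ℝ} (ht : t ∈ samplingInterval p k)
    (h : HasDerivWithinAt f f' (samplingInterval p k) t) : HasDerivWithinAt f f' (Ici t) t :=
  h.mono_of_mem_nhdsWithin (Ico_mem_nhdsGE_of_mem ht)

lemma samplingInterval_length (k : ℕ) : ((k + 1 : ℕ) : ℝ) * p.T - k * p.T = p.T := by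
  push_cast; ring

lemma Icc_sampling_subset_Ici (k : ℕ) :
    Icc ((k : ℝ) * p.T) (((k + 1 : ℕ) : ℝ) * p.T) ⊆ Ici 0 := fun _ ht =>
  (mul_nonneg (Nat.cast_nonneg k) p.T_pos.le).trans ht.1

/-- Expresses the thresholds at `kT` as powers of the common ratio `ρ = e^{-rate T}`. -/
lemma exp_threshold_le {rate γ : ℝ} (h : rate ≤ γ) (k : ℕ) :
    Real.exp (-γ * (k * p.T)) ≤ Real.exp (-rate * p.T) ^ k := by
  rw [← Real.exp_nat_mul, Real.exp_le_exp]
  have := mul_le_mul_of_nonneg_right h (mul_nonneg (Nat.cast_nonneg k) p.T_pos.le)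
  linarith

/-- The matrix estimates converge geometrically, at all times and at the event times. -/
lemma IsObserverTrajectory.exists_matrix_bound (h : IsObserverTrajectory G p S v Sh vh)
    {q rate : ℝ} (hq : 0 ≤ q) (hqr : q < Real.exp (-rate * p.T)) (hr : 0 < rate)
    (hrS : rate ≤ p.γS) (hH : StepContracts (Matrix (Fin n) (Fin n) ℝ) (graphH G) (p.μ₁ * p.T) q) :
    ∃ D, 0 ≤ D ∧
      (∀ k : ℕ, ∀ t ∈ Icc ((k : ℝ) * p.T) (((k + 1 : ℕ) : ℝ) * p.T), ∀ i : Fin N,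
        ‖Sh i.succ t - S‖ ≤ D * Real.exp (-rate * p.T) ^ k) ∧
      ∀ (k : ℕ) (i : Fin N), ‖Sh i.succ (latestEvent p (Sh i.succ) (vh i.succ) k) - S‖
        ≤ D * Real.exp (-rate * p.T) ^ k := by
  set ρ := Real.exp (-rate * p.T)
  have hρ0 : 0 < ρ := Real.exp_pos _
  have hρ1 : ρ < 1 := Real.exp_lt_one_iff.2 (by have := mul_pos hr p.T_pos; linarith)
  have hT := p.T_pos
  have hμ := p.μ₁_pos
  have hι := p.ιS_pos
  set K := ∑ i, ∑ j, |graphH G i j|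
  have hK : 0 ≤ K := Finset.sum_nonneg fun i _ => Finset.sum_nonneg fun j _ => abs_nonneg _
  set e : ℕ → Fin N → Matrix (Fin n) (Fin n) ℝ := fun k i =>
    Sh i.succ (k * p.T) - Sh i.succ (latestEvent p (Sh i.succ) (vh i.succ) k)
  have he : ∀ k i, ‖e k i‖ ≤ n * p.ιS * ρ ^ k := fun k i =>
    (norm_sub_latestEvent_le p (Sh i.succ) (vh i.succ) k).trans
      (mul_le_mul_of_nonneg_left (exp_threshold_le hrS k) (by positivity))
  have hek : ∀ k, ‖e k‖ ≤ n * p.ιS * ρ ^ k := fun k =>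
    (pi_norm_le_iff_of_nonneg (by positivity)).2 (he k)
  set x : ℝ → Fin N → Matrix (Fin n) (Fin n) ℝ := fun t i => Sh i.succ t - S
  obtain ⟨D, hD, hx⟩ := exists_decay_bound (x := x) (C := p.μ₁ * (K * (n * p.ιS)) * p.T)
    hμ.le hT.le hq hqr hρ1 hH (by positivity) (by
      intro k t ht
      have hcomp : ∀ i, ‖x t i - x (k * p.T) i
          - (t - k * p.T) • -(p.μ₁ • tupleMul (graphH G) (x (k * p.T)) i)‖
          ≤ p.μ₁ * (K * (n * p.ιS * ρ ^ k)) * p.T := by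
        intro i
        -- The matrix estimates move with constant velocity on the interval, so there is no
        -- state-dependent drift, and the velocity misses its ideal value `-μ₁ H x` only by `μ₁ H
        -- e`.
        have h1 := norm_sub_sub_smul_le (f := fun t => x t i) (g := fun _ => 0)
          (w := fun _ => p.μ₁ • ∑ j, weight G i.succ j •
            (Sh j (latestEvent p (Sh j) (vh j) k) -
              Sh i.succ (latestEvent p (Sh i.succ) (vh i.succ) k)))
          (w₀ := -(p.μ₁ • tupleMul (graphH G) (x (k * p.T)) i)) (δ := 0) (δ₀ := 0) (c := 0)
          (η := p.μ₁ * (K * (n * p.ιS * ρ ^ k)))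
          (((h.continuous_S i).mono (Icc_sampling_subset_Ici k)).sub continuousOn_const)
          (fun s hs => by
            rw [zero_add]
            exact ((h.deriv_S i k s hs).of_samplingInterval hs).sub_const S)
          le_rfl le_rfl le_rfl (by positivity) (fun s _ => by simp) (fun s _ => by
            have h2 := sum_weight_smul_sub G (fun j => Sh j (latestEvent p (Sh j) (vh j) k)) i
            rw [h2, h.leader_S _ (latestEvent_nonneg _ _ _ _)]
            have h3 : p.μ₁ • -∑ j, graphH G i j •
                (Sh j.succ (latestEvent p (Sh j.succ) (vh j.succ) k) - S)
                - -(p.μ₁ • tupleMul (graphH G) (x (k * p.T)) i)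
                = p.μ₁ • tupleMul (graphH G) (e k) i := by
              rw [smul_neg, sub_neg_eq_add, neg_add_eq_sub, ← smul_sub]
              congr 1
              simp only [tupleMul, ← Finset.sum_sub_distrib, ← smul_sub, x, e]
              refine Finset.sum_congr rfl fun j _ => ?_
              congr 1
              abel
            rw [h3, norm_smul, Real.norm_of_nonneg hμ.le]
            gcongr
            exact ((norm_le_pi_norm _ i).trans (norm_tupleMul_le _ _)).trans (by gcongr; exact hek k))
          ht
        rw [samplingInterval_length] at h1
        simpa using h1
      have h4 : x t - x (k * p.T) + (p.μ₁ * (t - k * p.T)) • tupleMul (graphH G) (x (k * p.T))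
          = fun i => x t i - x (k * p.T) i
            - (t - k * p.T) • -(p.μ₁ • tupleMul (graphH G) (x (k * p.T)) i) := by
        funext i
        simp only [Pi.add_apply, Pi.sub_apply, Pi.smul_apply, smul_neg, sub_neg_eq_add, smul_smul,
          mul_comm]
      rw [h4]
      refine ((pi_norm_le_iff_of_nonneg (by positivity)).2 hcomp).trans ?_
      have h5 : 0 ≤ p.μ₁ * (K * (n * p.ιS)) * p.T * ρ ^ k * ‖x (k * p.T)‖ := by positivity
      linarith)
  refine ⟨D + n * p.ιS, by positivity, fun k t ht i => ?_, fun k i => ?_⟩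
  · refine ((norm_le_pi_norm (x t) i).trans (hx k t ht)).trans ?_
    gcongr
    have : 0 ≤ n * p.ιS := by positivity
    linarith
  · have h1 := (norm_le_pi_norm (x (k * p.T)) i).trans
      (hx k (k * p.T) ⟨le_rfl, by push_cast; nlinarith⟩)
    have h2 : Sh i.succ (latestEvent p (Sh i.succ) (vh i.succ) k) - S
        = x (k * p.T) i - e k i := by simp only [x, e]; abel
    rw [h2, add_mul]
    exact (norm_sub_le _ _).trans (add_le_add h1 (he k i))

/-- The vector estimates converge geometrically when the matrix estimates do. -/
lemma IsObserverTrajectory.exists_vector_bound (h : IsObserverTrajectory G p S v Sh vh)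
    (hv : IsLeaderTrajectory S v) {B : ℝ} (hB0 : 0 ≤ B) (hB : ∀ t, ‖matrixFlow S t‖ ≤ B)
    {q rate D : ℝ} (hq : 0 ≤ q) (hqr : q < Real.exp (-rate * p.T)) (hr : 0 < rate)
    (hrv : rate ≤ p.γv) (hH : StepContracts (Fin n → ℝ) (graphH G) (p.μ₂ * p.T) q) (hD : 0 ≤ D)
    (hS : ∀ (k : ℕ) (i : Fin N), ‖Sh i.succ (latestEvent p (Sh i.succ) (vh i.succ) k) - S‖
        ≤ D * Real.exp (-rate * p.T) ^ k) :
    ∃ D', 0 ≤ D' ∧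
      ∀ k : ℕ, ∀ t ∈ Icc ((k : ℝ) * p.T) (((k + 1 : ℕ) : ℝ) * p.T), ∀ i : Fin N,
        ‖vh i.succ t - v t‖ ≤ D' * Real.exp (-rate * p.T) ^ k := by
  set ρ := Real.exp (-rate * p.T)
  have hρ0 : 0 < ρ := Real.exp_pos _
  have hρ1 : ρ < 1 := Real.exp_lt_one_iff.2 (by have := mul_pos hr p.T_pos; linarith)
  have hT := p.T_pos
  have hμ := p.μ₂_pos
  have hι := p.ιv_pos
  have hρk : ∀ k : ℕ, ρ ^ k ≤ 1 := fun k => pow_le_one₀ hρ0.le hρ1.le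
  have hflow := norm_matrixFlow_mulVec_le hB
  have hback : ∀ (t : ℝ) (x : Fin n → ℝ), matrixFlow S t *ᵥ (matrixFlow S (-t) *ᵥ x) = x :=
    fun t x => by rw [mulVec_mulVec, matrixFlow_mul_neg, one_mulVec]
  set K := ∑ i, ∑ j, |graphH G i j|
  have hK : 0 ≤ K := Finset.sum_nonneg fun i _ => Finset.sum_nonneg fun j _ => abs_nonneg _
  -- the estimates and the predictions in the moving frame
  set y : Fin (N + 1) → ℝ → Fin n → ℝ := fun j t => matrixFlow S (-t) *ᵥ vh j t with hy
  set z : ℕ → Fin (N + 1) → ℝ → Fin n → ℝ := fun k j t =>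
    matrixFlow S (-t) *ᵥ vbar (Sh j) (vh j) (latestEvent p (Sh j) (vh j) k) t with hz
  set c := ‖v 0‖
  set x : ℝ → Fin N → Fin n → ℝ := fun t i => y i.succ t - v 0 with hx
  have hframe : ∀ t, 0 ≤ t → matrixFlow S (-t) *ᵥ v t = v 0 := fun t ht => by
    rw [hv.eq_matrixFlow_mulVec ht, mulVec_mulVec, matrixFlow_neg_mul, one_mulVec]
  have hy0 : ∀ t, 0 ≤ t → y 0 t = v 0 := fun t ht => by
    simp only [hy, h.leader_v t ht]
    exact hframe t ht
  have hz0 : ∀ k t, 0 ≤ t → z k 0 t = v 0 := fun k t ht => by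
    have h1 := latestEvent_nonneg p (Sh 0) (vh 0) k
    have h2 : vbar (Sh 0) (vh 0) (latestEvent p (Sh 0) (vh 0) k) t = v t := by
      rw [vbar_eq, h.leader_S _ h1, h.leader_v _ h1, hv.eq_matrixFlow_mulVec h1,
        hv.eq_matrixFlow_mulVec ht, mulVec_mulVec, ← matrixFlow_add, sub_add_cancel]
    simp only [hz, h2]
    exact hframe t ht
  have hyx : ∀ i t, ‖y i.succ t‖ ≤ ‖x t i‖ + c := fun i t => by
    have := norm_add_le (x t i) (v 0)
    simpa [hx] using this
  -- Leaving the frame and returning to it costs a factor `B` each.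
  set δ₀ := B * (D * B)
  have hδ₀ : 0 ≤ δ₀ := by positivity
  have hpert : ∀ (k : ℕ) (i : Fin N) (t : ℝ) (u : Fin n → ℝ), ‖matrixFlow S (-t) *ᵥ
      ((Sh i.succ (latestEvent p (Sh i.succ) (vh i.succ) k) - S) *ᵥ u)‖
        ≤ δ₀ * ρ ^ k * ‖matrixFlow S (-t) *ᵥ u‖ := by
    intro k i t u
    calc _ ≤ B * (D * ρ ^ k * ‖matrixFlow S t *ᵥ (matrixFlow S (-t) *ᵥ u)‖) := by
          rw [hback]
          refine (hflow _ _).trans ?_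
          gcongr
          exact (Matrix.linfty_opNorm_mulVec _ _).trans (by gcongr; exact hS k i)
      _ ≤ B * (D * ρ ^ k * (B * ‖matrixFlow S (-t) *ᵥ u‖)) := by gcongr; exact hflow _ _
      _ = _ := by ring
  -- The first term is the triggering threshold at `kT`; the second is the drift of the prediction
  -- during the interval, caused by the error of the transmitted matrix.
  set Cz := B * p.ιv + δ₀ * (Real.exp (δ₀ * p.T) * (1 + c + B * p.ιv)) * p.T
  have hCz : 0 ≤ Cz := by positivity
  have hzy : ∀ (k : ℕ) (j : Fin (N + 1)), ∀ t ∈ Icc ((k : ℝ) * p.T) (((k + 1 : ℕ) : ℝ) * p.T),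
      ‖z k j t - y j (k * p.T)‖ ≤ Cz * ρ ^ k * (1 + ‖x (k * p.T)‖) := by
    intro k j t ht
    have hkT : 0 ≤ (k : ℝ) * p.T := by positivity
    induction j using Fin.cases with
    | zero =>
      rw [hz0 k t (hkT.trans ht.1), hy0 _ hkT, sub_self, norm_zero]
      positivity
    | succ i =>
      have hder : ∀ s, HasDerivAt (z k i.succ) (matrixFlow S (-s) *ᵥ
          ((Sh i.succ (latestEvent p (Sh i.succ) (vh i.succ) k) - S) *ᵥ
            vbar (Sh i.succ) (vh i.succ) (latestEvent p (Sh i.succ) (vh i.succ) k) s)) s := by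
        intro s
        rw [← hasDerivWithinAt_univ]
        have h1 := HasDerivWithinAt.matrixFlow_neg_mulVec S (g := 0) (s := univ) (by
          rw [add_zero, hasDerivWithinAt_univ]
          exact hasDerivAt_vbar (Sh i.succ) (vh i.succ)
            (latestEvent p (Sh i.succ) (vh i.succ) k) s)
        rwa [mulVec_zero, add_zero] at h1
      have h1 := norm_sub_le_of_norm_deriv_le_mul (z := z k i.succ) (δ := δ₀ * ρ ^ k) (δ₀ := δ₀)
        (fun s _ => (hder s).continuousAt.continuousWithinAt)
        (fun s _ => (hder s).hasDerivWithinAt) (by positivity)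
        (mul_le_of_le_one_right hδ₀ (hρk k)) (fun s _ => hpert k i s _) ht
      rw [samplingInterval_length] at h1
      have h2 : ‖z k i.succ (k * p.T) - y i.succ (k * p.T)‖ ≤ B * p.ιv * ρ ^ k := by
        simp only [hz, hy]
        rw [← mulVec_sub, mul_assoc]
        refine (hflow _ _).trans ?_
        gcongr
        rw [norm_sub_rev]
        exact (norm_sub_vbar_latestEvent_le p (Sh i.succ) (vh i.succ) k).trans
          (mul_le_mul_of_nonneg_left (exp_threshold_le hrv k) hι.le)
      have h3 : ‖z k i.succ (k * p.T)‖ ≤ (1 + c + B * p.ιv) * (1 + ‖x (k * p.T)‖) := by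
        have h4 := norm_add_le (z k i.succ (k * p.T) - y i.succ (k * p.T)) (y i.succ (k * p.T))
        rw [sub_add_cancel] at h4
        have h5 := hyx i (k * p.T)
        have h6 := norm_le_pi_norm (x (k * p.T)) i
        have h7 : B * p.ιv * ρ ^ k ≤ B * p.ιv := mul_le_of_le_one_right (by positivity) (hρk k)
        have h8 : 0 ≤ (c + B * p.ιv) * ‖x (k * p.T)‖ := by positivity
        linarith
      have h9 : z k i.succ t - y i.succ (k * p.T) = (z k i.succ (k * p.T) - y i.succ (k * p.T))
          + (z k i.succ t - z k i.succ (k * p.T)) := by abel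
      rw [h9]
      calc _ ≤ B * p.ιv * ρ ^ k + δ₀ * ρ ^ k * (Real.exp (δ₀ * p.T) *
            ((1 + c + B * p.ιv) * (1 + ‖x (k * p.T)‖))) * p.T :=
            (norm_add_le _ _).trans (add_le_add h2 (h1.trans (by gcongr)))
        _ ≤ B * p.ιv * ρ ^ k * (1 + ‖x (k * p.T)‖) + δ₀ * ρ ^ k * (Real.exp (δ₀ * p.T) *
            ((1 + c + B * p.ιv) * (1 + ‖x (k * p.T)‖))) * p.T := by
            refine add_le_add (le_mul_of_one_le_right (by positivity) ?_) le_rfl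
            linarith [norm_nonneg (x (k * p.T))]
        _ = _ := by ring
  -- The coupling has `N + 1` terms, each comparing two predictions that are off by `Cz` at most, up
  -- to the factor `ρ ^ k * (1 + X)`.
  set η₀ := p.μ₂ * ((N + 1) * (2 * Cz))
  have hη₀ : 0 ≤ η₀ := by positivity
  set R₀ := (1 + (δ₀ * c + p.μ₂ * K + η₀)) * Real.exp ((δ₀ + 1) * p.T)
  have hR₀ : 0 ≤ R₀ := by positivity
  obtain ⟨D', hD', hxD⟩ := exists_decay_bound (x := x) (C := (δ₀ * (R₀ + c) + η₀) * p.T)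
    hμ.le hT.le hq hqr hρ1 hH (by positivity) (by
      intro k t ht
      set X := ‖x (k * p.T)‖ with hX
      have hX0 : 0 ≤ X := norm_nonneg _
      have hcomp : ∀ i, ‖x t i - x (k * p.T) i
          - (t - k * p.T) • -(p.μ₂ • tupleMul (graphH G) (x (k * p.T)) i)‖
          ≤ (δ₀ * (R₀ + c) + η₀) * p.T * ρ ^ k * (1 + X) := by
        intro i
        set w₀ : Fin n → ℝ := -(p.μ₂ • tupleMul (graphH G) (x (k * p.T)) i) with hw₀
        have hw₀X : ‖w₀‖ ≤ p.μ₂ * K * X := by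
          rw [hw₀, norm_neg, norm_smul, Real.norm_of_nonneg hμ.le, mul_assoc]
          gcongr
          exact (norm_le_pi_norm _ i).trans (norm_tupleMul_le _ _)
        -- In the frame, `g` is the drift left by the matrix error, `w` the coupling through
        -- predictions, and `w₀` the coupling through the exact values at `kT`.
        have h1 := norm_sub_sub_smul_le (f := fun t => x t i)
          (g := fun s => matrixFlow S (-s) *ᵥ
            ((Sh i.succ (latestEvent p (Sh i.succ) (vh i.succ) k) - S) *ᵥ vh i.succ s))
          (w := fun s => p.μ₂ • ∑ j, weight G i.succ j • (z k j s - z k i.succ s))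
          (w₀ := w₀) (δ := δ₀ * ρ ^ k) (δ₀ := δ₀) (c := c) (η := η₀ * ρ ^ k * (1 + X))
          (a := k * p.T) (b := ((k + 1 : ℕ) : ℝ) * p.T)
          (by
            refine ContinuousOn.sub ?_ continuousOn_const
            refine Continuous.continuousOn (f := fun q : Matrix (Fin n) (Fin n) ℝ × (Fin n → ℝ) =>
              q.1 *ᵥ q.2) (by fun_prop) |>.comp (t := univ) (ContinuousOn.prodMk
                ((continuous_matrixFlow S).comp continuous_neg).continuousOn
                ((h.continuous_v i).mono (Icc_sampling_subset_Ici k))) (mapsTo_univ _ _))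
          (fun s hs => by
            have h2 := HasDerivWithinAt.matrixFlow_neg_mulVec S
              ((h.deriv_v i k s hs).of_samplingInterval hs)
            convert h2.sub_const (v 0) using 2
            rw [mulVec_smul]
            congr 1
            change _ = (mulVecLin (matrixFlow S (-s))) _
            rw [map_sum]
            refine Finset.sum_congr rfl fun j _ => ?_
            rw [map_smul, map_sub]
            rfl)
          (by positivity) (mul_le_of_le_one_right hδ₀ (hρk k)) (norm_nonneg _) (by positivity)
          (fun s _ => (hpert k i s _).trans (mul_le_mul_of_nonneg_left (hyx i s) (by positivity)))
          (fun s hs => by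
            have hs' := Ico_subset_Icc_self hs
            have h2 : w₀ = p.μ₂ • ∑ j, weight G i.succ j • (y j (k * p.T) - y i.succ (k * p.T)) := by
              rw [sum_weight_smul_sub G (fun j => y j (k * p.T)) i, smul_neg,
                hy0 _ (by positivity)]
              rfl
            rw [h2, ← smul_sub, ← Finset.sum_sub_distrib, norm_smul, Real.norm_of_nonneg hμ.le]
            have h3 : ∀ j, ‖weight G i.succ j • (z k j s - z k i.succ s)
                - weight G i.succ j • (y j (k * p.T) - y i.succ (k * p.T))‖
                ≤ 2 * Cz * ρ ^ k * (1 + X) := by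
              intro j
              rw [← smul_sub, norm_smul, Real.norm_of_nonneg (weight_nonneg _ _ _)]
              refine (mul_le_of_le_one_left (norm_nonneg _) (weight_le_one _ _ _)).trans ?_
              have h4 : z k j s - z k i.succ s - (y j (k * p.T) - y i.succ (k * p.T))
                  = (z k j s - y j (k * p.T)) - (z k i.succ s - y i.succ (k * p.T)) := by abel
              rw [h4]
              refine (norm_sub_le _ _).trans ?_
              linarith [hzy k j s hs', hzy k i.succ s hs']
            calc _ ≤ p.μ₂ * ∑ j : Fin (N + 1), 2 * Cz * ρ ^ k * (1 + X) := by
                  gcongr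
                  exact (norm_sum_le _ _).trans (Finset.sum_le_sum fun j _ => h3 j)
              _ = _ := by
                  rw [Finset.sum_const, Finset.card_univ, Fintype.card_fin, nsmul_eq_mul]
                  push_cast
                  ring) ht
        rw [samplingInterval_length] at h1
        refine h1.trans ?_
        have h5 : (‖x (k * p.T) i‖ + (δ₀ * c + ‖w₀‖ + η₀ * ρ ^ k * (1 + X)))
            * Real.exp ((δ₀ + 1) * p.T) ≤ R₀ * (1 + X) := by
          have h6 : ‖x (k * p.T) i‖ ≤ X := norm_le_pi_norm _ i
          have h7 : η₀ * ρ ^ k * (1 + X) ≤ η₀ * (1 + X) := by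
            gcongr
            exact mul_le_of_le_one_right hη₀ (hρk k)
          have h8 : 0 ≤ δ₀ * c * X + p.μ₂ * K := by positivity
          calc _ ≤ ((1 + (δ₀ * c + p.μ₂ * K + η₀)) * (1 + X)) * Real.exp ((δ₀ + 1) * p.T) := by
                gcongr
                linarith
            _ = _ := by ring
        have hc0 : 0 ≤ c := norm_nonneg _
        calc _ ≤ (δ₀ * ρ ^ k * (R₀ * (1 + X) + c * (1 + X)) + η₀ * ρ ^ k * (1 + X)) * p.T := by
              gcongr
              exact le_mul_of_one_le_right hc0 (by linarith)
          _ = _ := by ring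
      have h4 : x t - x (k * p.T) + (p.μ₂ * (t - k * p.T)) • tupleMul (graphH G) (x (k * p.T))
          = fun i => x t i - x (k * p.T) i
            - (t - k * p.T) • -(p.μ₂ • tupleMul (graphH G) (x (k * p.T)) i) := by
        funext i
        simp only [Pi.add_apply, Pi.sub_apply, Pi.smul_apply, smul_neg, sub_neg_eq_add, smul_smul,
          mul_comm]
      rw [h4]
      exact (pi_norm_le_iff_of_nonneg (by positivity)).2 hcomp)
  refine ⟨B * D', by positivity, fun k t ht i => ?_⟩
  have h1 : vh i.succ t - v t = matrixFlow S t *ᵥ x t i := by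
    rw [hx, mulVec_sub, hback, ← hv.eq_matrixFlow_mulVec (Icc_sampling_subset_Ici k ht)]
  rw [h1, mul_assoc]
  refine (hflow _ _).trans ?_
  gcongr
  exact (norm_le_pi_norm (x t) i).trans (hxD k t ht)

end Decay

/-! ### Existence of observer trajectories -/

section Existence

open scoped Matrix.Norms.Operator

/-- Variation of constants. -/
lemma exists_hasDerivAt_mulVec_add {n : ℕ} (A : Matrix (Fin n) (Fin n) ℝ) {g : ℝ → Fin n → ℝ}
    (hg : Continuous g) (a : ℝ) (u₀ : Fin n → ℝ) :
    ∃ u : ℝ → Fin n → ℝ, u a = u₀ ∧ ∀ t, HasDerivAt u (A *ᵥ u t + g t) t := by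
  have hcont : Continuous fun s => matrixFlow A (a - s) *ᵥ g s :=
    ((continuous_matrixFlow A).comp (continuous_const.sub continuous_id)).matrix_mulVec hg
  refine ⟨fun t => matrixFlow A (t - a) *ᵥ (u₀ + ∫ s in a..t, matrixFlow A (a - s) *ᵥ g s), ?_,
    fun t => ?_⟩
  · simp [matrixFlow_zero]
  · have h1 : HasDerivAt (fun t => matrixFlow A (t - a)) (A * matrixFlow A (t - a)) t :=
      HasDerivAt.comp_sub_const t a (hasDerivAt_matrixFlow A (t - a))
    have h2 : HasDerivAt (fun t => u₀ + ∫ s in a..t, matrixFlow A (a - s) *ᵥ g s)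
        (matrixFlow A (a - t) *ᵥ g t) t :=
      ((hcont.integral_hasStrictDerivAt a t).hasDerivAt).const_add u₀
    have h3 := HasDerivWithinAt.matrix_mulVec h1.hasDerivWithinAt (h2.hasDerivWithinAt (s := univ))
    rw [hasDerivWithinAt_univ] at h3
    refine h3.congr_deriv ?_
    rw [← mulVec_mulVec, mulVec_mulVec _ (matrixFlow A (t - a)) (matrixFlow A (a - t)),
      ← neg_sub t a, matrixFlow_mul_neg, one_mulVec]

/-- Events depend on the past only, so extending the estimates beyond `kT` leaves the earlier events
unchanged. -/
lemma latestEvent_congr {n : ℕ} (p : PETParams) {Sh Sh' : ℝ → Matrix (Fin n) (Fin n) ℝ}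
    {vh vh' : ℝ → Fin n → ℝ} {k : ℕ} (hS : ∀ t ≤ k * p.T, Sh t = Sh' t)
    (hv : ∀ t ≤ k * p.T, vh t = vh' t) : latestEvent p Sh vh k = latestEvent p Sh' vh' k := by
  induction k with
  | zero => rfl
  | succ k ih =>
    have hle : (k : ℝ) * p.T ≤ ((k + 1 : ℕ) : ℝ) * p.T := by
      have := p.T_pos.le
      gcongr
      exact k.le_succ
    have he := ih (fun t ht => hS t (ht.trans hle)) (fun t ht => hv t (ht.trans hle))
    have hs := (latestEvent_le p Sh' vh' k).trans hle
    rw [latestEvent, latestEvent]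
    refine if_congr (Iff.of_eq ?_) rfl he
    simp only [trigS, trigV, vbar, he, hS _ le_rfl, hv _ le_rfl, hS _ hs, hv _ hs]

lemma continuousOn_Ici_of_sampling {E : Type*} [TopologicalSpace E] {f : ℝ → E} {T : ℝ} (hT : 0 < T)
    (hf : ∀ k : ℕ, ContinuousOn f (Icc ((k : ℝ) * T) (((k + 1 : ℕ) : ℝ) * T))) :
    ContinuousOn f (Ici 0) := by
  have h1 : ∀ k : ℕ, ContinuousOn f (Icc 0 ((k : ℝ) * T)) := by
    intro k
    induction k with
    | zero => simp
    | succ k ih =>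
      have h2 := ih.union_of_isClosed (hf k) isClosed_Icc isClosed_Icc
      rwa [Icc_union_Icc_eq_Icc (by positivity) (by push_cast; nlinarith)] at h2
  intro t ht
  obtain ⟨k, hk⟩ := exists_nat_gt (t / T)
  rw [div_lt_iff₀ hT] at hk
  exact (h1 k t ⟨ht, hk.le⟩).mono_of_mem_nhdsWithin
    (mem_nhdsWithin.2 ⟨Iio (k * T), isOpen_Iio, hk, fun s hs => ⟨hs.2, hs.1.le⟩⟩)

variable {N n : ℕ} (G : Digraph (Fin (N + 1))) (p : PETParams)

/-- Estimates known up to the sampling instant `kT` extend over the next sampling interval. -/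
lemma exists_extension (k : ℕ) (X : Fin (N + 1) → ℝ → Matrix (Fin n) (Fin n) ℝ)
    (Y : Fin (N + 1) → ℝ → Fin n → ℝ) :
    ∃ (X' : Fin (N + 1) → ℝ → Matrix (Fin n) (Fin n) ℝ) (Y' : Fin (N + 1) → ℝ → Fin n → ℝ),
      (∀ j, ∀ t ≤ (k : ℝ) * p.T, X' j t = X j t ∧ Y' j t = Y j t) ∧
      X' 0 = X 0 ∧ Y' 0 = Y 0 ∧
      ∀ i : Fin N, ∃ (U : ℝ → Matrix (Fin n) (Fin n) ℝ) (V : ℝ → Fin n → ℝ),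
        (∀ t, (k : ℝ) * p.T ≤ t → X' i.succ t = U t ∧ Y' i.succ t = V t) ∧
        (∀ t, HasDerivAt U (p.μ₁ • ∑ j, weight G i.succ j •
          (X j (latestEvent p (X j) (Y j) k) -
            X i.succ (latestEvent p (X i.succ) (Y i.succ) k))) t) ∧
        ∀ t, HasDerivAt V (X i.succ (latestEvent p (X i.succ) (Y i.succ) k) *ᵥ V t +
          p.μ₂ • ∑ j, weight G i.succ j •
            (vbar (X j) (Y j) (latestEvent p (X j) (Y j) k) t -
              vbar (X i.succ) (Y i.succ) (latestEvent p (X i.succ) (Y i.succ) k) t)) t := by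
  have hvb : ∀ j, Continuous fun t => vbar (X j) (Y j) (latestEvent p (X j) (Y j) k) t := fun j =>
    continuous_iff_continuousAt.2 fun t => (hasDerivAt_vbar _ _ _ t).continuousAt
  have hV : ∀ i : Fin N, ∃ V : ℝ → Fin n → ℝ, V (k * p.T) = Y i.succ (k * p.T) ∧
      ∀ t, HasDerivAt V (X i.succ (latestEvent p (X i.succ) (Y i.succ) k) *ᵥ V t +
          p.μ₂ • ∑ j, weight G i.succ j •
            (vbar (X j) (Y j) (latestEvent p (X j) (Y j) k) t -
              vbar (X i.succ) (Y i.succ) (latestEvent p (X i.succ) (Y i.succ) k) t)) t := fun i =>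
    exists_hasDerivAt_mulVec_add _ (g := fun t => p.μ₂ • ∑ j, weight G i.succ j •
      (vbar (X j) (Y j) (latestEvent p (X j) (Y j) k) t -
        vbar (X i.succ) (Y i.succ) (latestEvent p (X i.succ) (Y i.succ) k) t)) (by fun_prop) _ _
  choose V hV0 hV using hV
  let R : Fin N → Matrix (Fin n) (Fin n) ℝ := fun i => p.μ₁ • ∑ j, weight G i.succ j •
    (X j (latestEvent p (X j) (Y j) k) - X i.succ (latestEvent p (X i.succ) (Y i.succ) k))
  let U : Fin N → ℝ → Matrix (Fin n) (Fin n) ℝ := fun i t =>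
    X i.succ (k * p.T) + (t - k * p.T) • R i
  refine ⟨Fin.cons (X 0) fun i t => if t ≤ k * p.T then X i.succ t else U i t,
    Fin.cons (Y 0) fun i t => if t ≤ k * p.T then Y i.succ t else V i t, ?_, rfl, rfl,
    fun i => ⟨U i, V i, fun t ht => ?_, fun t => ?_, hV i⟩⟩
  · intro j t ht
    induction j using Fin.cases with
    | zero => exact ⟨rfl, rfl⟩
    | succ i => simp [ht]
  -- At `kT` itself the old branch is taken; it agrees with `U` and `V` by their initial values.
  · rcases ht.eq_or_lt with rfl | ht
    · simp [U, hV0]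
    · simp [not_le.2 ht]
  · have h1 := (((hasDerivAt_id t).sub_const (k * p.T)).smul_const (R i)).const_add
      (X i.succ (k * p.T))
    rw [one_smul] at h1
    exact h1

/-- The observer has a trajectory for all initial estimates. -/
lemma exists_isObserverTrajectory (S : Matrix (Fin n) (Fin n) ℝ) (v : ℝ → Fin n → ℝ)
    (S₀ : Fin N → Matrix (Fin n) (Fin n) ℝ) (v₀ : Fin N → Fin n → ℝ) :
    ∃ Sh vh, IsObserverTrajectory G p S v Sh vh ∧
      ∀ i : Fin N, Sh i.succ 0 = S₀ i ∧ vh i.succ 0 = v₀ i := by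
  have hT := p.T_pos
  choose stepX stepY hpast hX0 hY0 hnext using exists_extension (n := n) G p
  let F : ℕ → (Fin (N + 1) → ℝ → Matrix (Fin n) (Fin n) ℝ) × (Fin (N + 1) → ℝ → Fin n → ℝ) :=
    Nat.rec (Fin.cons (fun _ => S) fun i _ => S₀ i, Fin.cons v fun i _ => v₀ i)
      fun k f => (stepX k f.1 f.2, stepY k f.1 f.2)
  have hlead : ∀ k, (F k).1 0 = (fun _ => S) ∧ (F k).2 0 = v := by
    intro k
    induction k with
    | zero => exact ⟨rfl, rfl⟩
    | succ k ih => exact ⟨(hX0 k _ _).trans ih.1, (hY0 k _ _).trans ih.2⟩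
  have hstable : ∀ (k m : ℕ) j t, k ≤ m → t ≤ (k : ℝ) * p.T →
      (F m).1 j t = (F k).1 j t ∧ (F m).2 j t = (F k).2 j t := by
    intro k m j t hkm ht
    induction m, hkm using Nat.le_induction with
    | base => exact ⟨rfl, rfl⟩
    | succ m hkm ih =>
      have h1 := hpast m (F m).1 (F m).2 j t (ht.trans (by gcongr))
      exact ⟨h1.1.trans ih.1, h1.2.trans ih.2⟩
  -- Stage `k` is final up to time `kT`, and `⌈t / T⌉₊` is the first stage that reaches `t`.
  let Sh : Fin (N + 1) → ℝ → Matrix (Fin n) (Fin n) ℝ := fun j t => (F ⌈t / p.T⌉₊).1 j t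
  let vh : Fin (N + 1) → ℝ → Fin n → ℝ := fun j t => (F ⌈t / p.T⌉₊).2 j t
  have hagree : ∀ (k : ℕ) j t, t ≤ (k : ℝ) * p.T →
      Sh j t = (F k).1 j t ∧ vh j t = (F k).2 j t := by
    intro k j t ht
    have h1 := hstable ⌈t / p.T⌉₊ k j t (Nat.ceil_le.2 ((div_le_iff₀ hT).2 ht))
      ((div_le_iff₀ hT).1 (Nat.le_ceil _))
    exact ⟨h1.1.symm, h1.2.symm⟩
  have hev : ∀ k j, latestEvent p (Sh j) (vh j) k = latestEvent p ((F k).1 j) ((F k).2 j) k :=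
    fun k j => latestEvent_congr p (fun t ht => (hagree k j t ht).1) fun t ht => (hagree k j t ht).2
  have hevS : ∀ k j, Sh j (latestEvent p (Sh j) (vh j) k)
      = (F k).1 j (latestEvent p ((F k).1 j) ((F k).2 j) k) := fun k j => by
    rw [hev]
    exact (hagree k j _ (latestEvent_le _ _ _ _)).1
  have hevv : ∀ k j t, vbar (Sh j) (vh j) (latestEvent p (Sh j) (vh j) k) t
      = vbar ((F k).1 j) ((F k).2 j) (latestEvent p ((F k).1 j) ((F k).2 j) k) t := fun k j t => by
    rw [vbar, vbar, hevS, hev, (hagree k j _ (latestEvent_le _ _ _ _)).2]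
  choose U V hUV hU hV using fun k => hnext k (F k).1 (F k).2
  have hSU : ∀ (k : ℕ) i, ∀ t ∈ Icc ((k : ℝ) * p.T) (((k + 1 : ℕ) : ℝ) * p.T), Sh i.succ t = U k i t :=
    fun k i t ht => (hagree (k + 1) i.succ t ht.2).1.trans (hUV k i t ht.1).1
  have hvV : ∀ (k : ℕ) i, ∀ t ∈ Icc ((k : ℝ) * p.T) (((k + 1 : ℕ) : ℝ) * p.T), vh i.succ t = V k i t :=
    fun k i t ht => (hagree (k + 1) i.succ t ht.2).2.trans (hUV k i t ht.1).2
  refine ⟨Sh, vh, ⟨fun t _ => congrFun (hlead _).1 t, fun t _ => congrFun (hlead _).2 t,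
    fun i => continuousOn_Ici_of_sampling hT fun k => ?_,
    fun i => continuousOn_Ici_of_sampling hT fun k => ?_, fun i k t ht => ?_, fun i k t ht => ?_⟩,
    fun i => ?_⟩
  · exact ContinuousOn.congr (fun t _ => (hU k i t).continuousAt.continuousWithinAt) (hSU k i)
  · exact ContinuousOn.congr (fun t _ => (hV k i t).continuousAt.continuousWithinAt) (hvV k i)
  · simp only [hevS]
    exact (hU k i t).hasDerivWithinAt.congr (fun s hs => hSU k i s (Ico_subset_Icc_self hs))
      (hSU k i t (Ico_subset_Icc_self ht))
  · simp only [hevS, hevv]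
    rw [hvV k i t (Ico_subset_Icc_self ht)]
    exact (hV k i t).hasDerivWithinAt.congr (fun s hs => hvV k i s (Ico_subset_Icc_self hs))
      (hvV k i t (Ico_subset_Icc_self ht))
  · have h1 := hagree 0 i.succ 0 (by simp)
    exact h1

end Existence

/-! ### Assembly -/

section Main

open scoped Matrix.Norms.Operator

variable {N : ℕ} {G : Digraph (Fin (N + 1))}

/-- The rate must be slower than both the contraction and the thresholds; small rates qualify by
continuity at `0`. -/
lemma exists_pos_lt_exp {q T γ : ℝ} (hq : q < 1) (hγ : 0 < γ) :
    ∃ r, 0 < r ∧ r ≤ γ ∧ q < Real.exp (-r * T) := by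
  have hcont : Continuous fun r : ℝ => Real.exp (-r * T) := by fun_prop
  have h1 : ∀ᶠ r in nhdsWithin (0 : ℝ) (Ioi 0), q < Real.exp (-r * T) :=
    ((hcont.tendsto 0).mono_left nhdsWithin_le_nhds).eventually_const_lt (by simpa using hq)
  obtain ⟨r, hr1, hr2⟩ := (h1.and (Ioc_mem_nhdsGT hγ)).exists
  exact ⟨r, hr2.1, hr2.2, hr1⟩

/-- The observer estimates the leader exponentially when Euler steps with both gains are shorter
than the bound given by a Lyapunov matrix. -/
lemma exponentiallyEstimates_of_lyapunov {P : Matrix (Fin N) (Fin N) ℝ} (hP : P.PosDef)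
    (hL : P * graphH G + (graphH G)ᵀ * P = (2 : ℝ) • 1) {p : PETParams}
    (hT : p.T * max p.μ₁ p.μ₂ * ((twoNorm (P * graphH G) + 1) * twoNorm (graphH G)) ≤ 1)
    {n : ℕ} {S : Matrix (Fin n) (Fin n) ℝ} (hS : NeutrallyStable S) :
    ExponentiallyEstimates G p S := by
  have hTp := p.T_pos
  have hK : 0 ≤ (twoNorm (P * graphH G) + 1) * twoNorm (graphH G) :=
    mul_nonneg (by linarith [twoNorm_nonneg (P * graphH G)]) (twoNorm_nonneg _)
  have hgain : ∀ μ ≤ max p.μ₁ p.μ₂,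
      μ * p.T * ((twoNorm (P * graphH G) + 1) * twoNorm (graphH G)) ≤ 1 := fun μ hμ => by
    refine le_trans (mul_le_mul_of_nonneg_right ?_ hK) hT
    rw [mul_comm]
    exact mul_le_mul_of_nonneg_left hμ hTp.le
  obtain ⟨q₁, hq₁, hq₁1, hH₁⟩ := exists_stepContracts (Matrix (Fin n) (Fin n) ℝ) hP hL
    (mul_pos p.μ₁_pos hTp) (hgain _ (le_max_left _ _))
  obtain ⟨q₂, hq₂, hq₂1, hH₂⟩ := exists_stepContracts (Fin n → ℝ) hP hL
    (mul_pos p.μ₂_pos hTp) (hgain _ (le_max_right _ _))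
  obtain ⟨rate, hr, hrγ, hqr⟩ := exists_pos_lt_exp (T := p.T) (max_lt hq₁1 hq₂1)
    (lt_min p.γS_pos p.γv_pos)
  obtain ⟨B, hB0, hB⟩ := hS.exists_matrixFlow_bound
  refine ⟨rate, hr, fun v hv S₀ v₀ => ⟨exists_isObserverTrajectory G p S v S₀ v₀, ?_⟩⟩
  intro Sh vh h _
  obtain ⟨D, hD, hDS, hDe⟩ := h.exists_matrix_bound hq₁ ((le_max_left _ _).trans_lt hqr) hr
    (hrγ.trans (min_le_left _ _)) hH₁
  obtain ⟨D', hD', hDv⟩ := h.exists_vector_bound hv hB0 hB hq₂ ((le_max_right _ _).trans_lt hqr) hr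
    (hrγ.trans (min_le_right _ _)) hH₂ hD hDe
  -- The factor `n` passes to the Frobenius and Euclidean norms; `e^{rate T}` makes up for the time
  -- elapsed since the last sampling instant.
  refine ⟨n * (max D D' * Real.exp (rate * p.T)), fun t ht i => ?_⟩
  set k := ⌊t / p.T⌋₊
  have hk1 : (k : ℝ) * p.T ≤ t := (le_div_iff₀ hTp).1 (Nat.floor_le (div_nonneg ht hTp.le))
  have hk2 : t ≤ ((k + 1 : ℕ) : ℝ) * p.T := by
    rw [← div_le_iff₀ hTp]
    push_cast
    exact (Nat.lt_floor_add_one _).le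
  have hρ : Real.exp (-rate * p.T) ^ k ≤ Real.exp (rate * p.T) * Real.exp (-rate * t) := by
    rw [← Real.exp_nat_mul, ← Real.exp_add, Real.exp_le_exp]
    push_cast at hk2
    nlinarith
  have hbound : ∀ C ≤ max D D', n * (C * Real.exp (-rate * p.T) ^ k)
      ≤ n * (max D D' * Real.exp (rate * p.T)) * Real.exp (-rate * t) := fun C hC => by
    calc _ ≤ n * (max D D' * (Real.exp (rate * p.T) * Real.exp (-rate * t))) := by gcongr
      _ = _ := by ring
  exact ⟨((frobNorm_le_card_mul_norm _).trans (by gcongr; exact hDS k t ⟨hk1, hk2⟩ i)).trans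
      (hbound D (le_max_left _ _)),
    ((eucNorm_le_card_mul_norm _).trans (by gcongr; exact hDv k t ⟨hk1, hk2⟩ i)).trans
      (hbound D' (le_max_right _ _))⟩

end Main
end

theorem theorem1 (N : ℕ) (G : Digraph (Fin (N + 1)))
    (hloop : ∀ i, ¬ G.Adj i i) (hleader : ∀ i, ¬ G.Adj i 0)
    (htree : HasDirectedSpanningTree G 0) :
    (∃ p : PETParams, ∀ (n : ℕ) (S : Matrix (Fin n) (Fin n) ℝ), NeutrallyStable S →
      ExponentiallyEstimates G p S) ∧
    (∃ P : Matrix (Fin N) (Fin N) ℝ, P.PosDef ∧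
      P * graphH G + (graphH G)ᵀ * P = (2 : ℝ) • 1) ∧
    (∀ P : Matrix (Fin N) (Fin N) ℝ, P * graphH G + (graphH G)ᵀ * P = (2 : ℝ) • 1 →
      ∀ p : PETParams,
        p.T < 1 / (max p.μ₁ p.μ₂ * (twoNorm (P * graphH G) + 1) * twoNorm (graphH G)) →
        ∀ (n : ℕ) (S : Matrix (Fin n) (Fin n) ℝ), NeutrallyStable S →
          ExponentiallyEstimates G p S) := by
  obtain ⟨w, hw, hHw⟩ := exists_pos_graphH_mulVec_pos G htree
  have hoff : ∀ i j, i ≠ j → graphH G i j ≤ 0 := fun i j h => graphH_offDiag G h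
  have hpos : ∀ P : Matrix (Fin N) (Fin N) ℝ, P * graphH G + (graphH G)ᵀ * P = (2 : ℝ) • 1 →
      P.PosDef := fun P hP => lyapunov_posDef hoff (graphH_rowSum G) hw hHw hP
  have hK : ∀ P : Matrix (Fin N) (Fin N) ℝ,
      0 ≤ (twoNorm (P * graphH G) + 1) * twoNorm (graphH G) := fun P =>
    mul_nonneg (by linarith [twoNorm_nonneg (P * graphH G)]) (twoNorm_nonneg _)
  obtain ⟨P, hP⟩ := exists_lyapunov hoff (graphH_rowSum G) hw hHw
  refine ⟨?_, ⟨P, hpos P hP, hP⟩, fun P hP p hT n S hS =>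
    exponentiallyEstimates_of_lyapunov (hpos P hP) hP ?_ hS⟩
  -- The sampling period for unit gains; the final `+ 1` keeps the denominator positive when `N =
  -- 0`.
  · have h1 : 0 < 1 / ((twoNorm (P * graphH G) + 1) * twoNorm (graphH G) + 1) := by
      have := hK P
      positivity
    refine ⟨⟨1, 1, _, 1, 1, 1, 1, one_pos, one_pos, h1, one_pos, one_pos, one_pos, one_pos⟩,
      fun n S hS => exponentiallyEstimates_of_lyapunov (hpos P hP) hP ?_ hS⟩
    simp only [max_self, mul_one]
    rw [div_mul_eq_mul_div, one_mul, div_le_one (by have := hK P; positivity)]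
    linarith
  · have hμ : 0 < max p.μ₁ p.μ₂ := lt_max_of_lt_left p.μ₁_pos
    -- Since `1 / 0 = 0`, the condition `0 < T < 1 / …` itself forces the denominator to be
    -- positive.
    have h0 : 0 < 1 / (max p.μ₁ p.μ₂ * (twoNorm (P * graphH G) + 1) * twoNorm (graphH G)) :=
      p.T_pos.trans hT
    rw [lt_div_iff₀ (one_div_pos.1 h0)] at hT
    linarith
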